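/- Let $n\ge 2$, let $\lambda\subset\mathbb{R}^n$ be an arc (a set homeomorphic to the closed interval $[0,1]$), and let $\Omega\subset\mathbb{R}^n$ be an open set containing $\lambda$. Then there is a simple closed curve $\gamma$ (a set homeomorphic to the unit circle) such that $\lambda\subset\gamma\subset\Omega$ and such that the open arc $\gamma\setminus\lambda$ is $C^\infty$-smooth, that is, $\gamma\setminus\lambda=g(\mathbb{R})$ for some $C^\infty$ map $g:\mathbb{R}\to\mathbb{R}^n$ whose derivative vanishes nowhere and which is a homeomorphism onto its image. -/

import Mathlib

open scoped ContDiff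

/-- An arc: a set that, with the subspace topology, is homeomorphic to the closed unit interval. -/
def IsArc {X : Type*} [TopologicalSpace X] (S : Set X) : Prop :=
  Nonempty (S ≃ₜ unitInterval)

/-- A simple closed curve: a set that, with the subspace topology, is homeomorphic to the
unit circle. -/
def IsSimpleClosedCurve {X : Type*} [TopologicalSpace X] (S : Set X) : Prop :=
  Nonempty (S ≃ₜ Circle)

/-- A smooth open arc: the image of the real line under a smooth embedding, that is, under a
map of class `C^∞` whose derivative vanishes nowhere and which is a homeomorphism onto its image.
Equivalently, an embedded one-dimensional smooth submanifold that is homeomorphic to `ℝ`. -/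
def IsSmoothOpenArc {E : Type*} [NormedAddCommGroup E] [NormedSpace ℝ E] (S : Set E) : Prop :=
  ∃ g : ℝ → E, ContDiff ℝ ∞ g ∧ (∀ t, deriv g t ≠ 0) ∧ Topology.IsEmbedding g ∧ Set.range g = S

open Set Metric Filter Topology MeasureTheory

/-! The arc is closed up by a smooth curve running through a two-way infinite chain of balls off the
arc, shrinking to one end point in each direction. Such a chain exists because, in dimension at
least two, an arc neither separates a bounded connected open set containing it
(`isPreconnected_diff_range_arc`) nor separates small neighbourhoods of its end points
(`exists_ball_forall_mem_connectedComponentIn_ball_diff_range_arc`). Both facts follow from one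
separation argument: contract the arc, move a point past it, then expand the arc again. The
obstruction to separation is a degree-type statement, that a continuous map equal to a translation
off a bounded set has a zero. This reduces to the absence of a `C¹` retraction onto a sphere, proved
by the Milnor–Rogers volume argument.

The chain is pruned until only neighbouring sets meet. Its members are convex, so a polygonal line
with one vertex in each consecutive intersection stays inside it. Vertices are chosen with no three
consecutive ones collinear; each corner can then be rounded to a regular injective curve.
Disjointness of distant members makes the whole curve injective. It converges to the two end points
of the arc, which makes it an embedding and closes the union into a circle. -/

theorem Matrix.det_one_add_smul_eq_sum {ι : Type*} [Fintype ι] [DecidableEq ι]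
    (M : Matrix ι ι ℝ) (t : ℝ) :
    (1 + t • M).det = ∑ σ : Equiv.Perm ι, ∑ S : Finset ι,
      t ^ (Finset.univ \ S).card * (((Equiv.Perm.sign σ : ℤ) : ℝ) *
        ((∏ i ∈ S, (1 : Matrix ι ι ℝ) (σ i) i) * ∏ i ∈ Finset.univ \ S, M (σ i) i)) := by
  rw [Matrix.det_apply']
  refine Finset.sum_congr rfl fun σ _ => ?_
  simp only [Matrix.add_apply, Matrix.smul_apply, smul_eq_mul]
  rw [Finset.prod_add, Finset.mul_sum, Finset.powerset_univ]
  refine Finset.sum_congr rfl fun S _ => ?_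
  rw [Finset.prod_mul_distrib, Finset.prod_const]
  ring

/-! ### No retraction onto a sphere, and zeros of maps that are translations near infinity. -/

section Euclidean

variable {E : Type*} [NormedAddCommGroup E] [InnerProductSpace ℝ E] [FiniteDimensional ℝ E]

/-- The integral of `det (1 + t A)` over a compact set is a polynomial function of `t`. -/
theorem exists_polynomial_setIntegral_det [MeasurableSpace E] [BorelSpace E]
    {A : E → E →L[ℝ] E} {K : Set E} (hK : IsCompact K) (hA : Continuous A) :
    ∃ P : Polynomial ℝ, ∀ t : ℝ, ∫ x in K, (1 + t • A x).det = P.eval t := by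
  classical
  let b := Module.finBasis ℝ E
  let M : E → Matrix _ _ ℝ := fun x => LinearMap.toMatrix b b (A x : E →ₗ[ℝ] E)
  have hM : ∀ i j, Continuous fun x => M x i j := by
    intro i j
    simp only [M, LinearMap.toMatrix_apply]
    have : Continuous fun v : E => b.repr v i :=
      LinearMap.continuous_of_finiteDimensional ((b.coord i))
    exact this.comp (hA.clm_apply continuous_const)
  have hdet : ∀ (t : ℝ) x, (1 + t • A x).det = (1 + t • M x).det := by
    intro t x
    rw [ContinuousLinearMap.det, ← LinearMap.det_toMatrix b]
    congr 1
    simp only [M]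
    rw [ContinuousLinearMap.toLinearMap_add, ContinuousLinearMap.toLinearMap_smul, map_add, map_smul]
    congr 1
    exact LinearMap.toMatrix_one b
  let c : Equiv.Perm (Fin (Module.finrank ℝ E)) → Finset (Fin (Module.finrank ℝ E)) → E → ℝ :=
    fun σ S x => ((Equiv.Perm.sign σ : ℤ) : ℝ) *
        ((∏ i ∈ S, (1 : Matrix _ _ ℝ) (σ i) i) * ∏ i ∈ Finset.univ \ S, M x (σ i) i)
  have hc : ∀ σ S, Continuous (c σ S) := fun σ S => by
    refine continuous_const.mul (continuous_const.mul ?_)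
    exact continuous_finsetProd _ fun i _ => hM _ _
  refine ⟨∑ σ, ∑ S, Polynomial.C (∫ x in K, c σ S x) *
    Polynomial.X ^ (Finset.univ \ S : Finset (Fin (Module.finrank ℝ E))).card, fun t => ?_⟩
  have hint : ∀ σ S, IntegrableOn (c σ S) K := fun σ S => (hc σ S).continuousOn.integrableOn_compact hK
  calc ∫ x in K, (1 + t • A x).det
      = ∫ x in K, ∑ σ, ∑ S, t ^ (Finset.univ \ S : Finset _).card * c σ S x := by
        refine integral_congr_ae (Eventually.of_forall fun x => ?_)
        simp only [hdet, Matrix.det_one_add_smul_eq_sum, c]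
    _ = ∑ σ, ∑ S, t ^ (Finset.univ \ S : Finset _).card * ∫ x in K, c σ S x := by
        rw [integral_finsetSum _ fun σ _ => integrable_finsetSum _ fun S _ => (hint σ S).const_mul _]
        refine Finset.sum_congr rfl fun σ _ => ?_
        rw [integral_finsetSum _ fun S _ => (hint σ S).const_mul _]
        refine Finset.sum_congr rfl fun S _ => ?_
        rw [integral_const_mul]
    _ = _ := by
        simp only [Polynomial.eval_finsetSum, Polynomial.eval_mul, Polynomial.eval_C,
          Polynomial.eval_pow, Polynomial.eval_X]
        exact Finset.sum_congr rfl fun σ _ => Finset.sum_congr rfl fun S _ => mul_comm _ _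

omit [FiniteDimensional ℝ E] in
/-- Extending a Lipschitz map on a ball that vanishes on the sphere by zero. -/
theorem LipschitzOnWith.indicator_closedBall {k : E → E} {C : NNReal} {R : ℝ}
    (hk : LipschitzOnWith C k (closedBall 0 R)) (h0 : ∀ x, ‖x‖ = R → k x = 0) :
    LipschitzWith C ((closedBall 0 R).indicator k) := by
  classical
  have key : ∀ x y, x ∈ closedBall (0 : E) R → y ∉ closedBall (0 : E) R → ‖k x‖ ≤ C * ‖x - y‖ := by
    intro x y hx hy
    rw [mem_closedBall_zero_iff] at hx hy
    -- The segment from `x` to `y` crosses the sphere at a point where `k` vanishes, and that point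
    -- is no farther from `x` than `y` is.
    obtain ⟨s, hs, hsR⟩ : ∃ s ∈ Icc (0 : ℝ) 1, ‖AffineMap.lineMap x y s‖ = R := by
      have hcont : ContinuousOn (fun s : ℝ => ‖AffineMap.lineMap x y s‖) (Icc 0 1) :=
        (AffineMap.lineMap_continuous.norm).continuousOn
      have := intermediate_value_Icc zero_le_one hcont
      have h2 : R ∈ Icc ‖AffineMap.lineMap x y (0 : ℝ)‖ ‖AffineMap.lineMap x y (1 : ℝ)‖ := by
        simp only [AffineMap.lineMap_apply_zero, AffineMap.lineMap_apply_one]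
        exact ⟨hx, (not_le.1 hy).le⟩
      exact this h2
    set z := AffineMap.lineMap x y s
    have h1 := hk.norm_sub_le (mem_closedBall_zero_iff.2 hx) (mem_closedBall_zero_iff.2 hsR.le)
    rw [h0 z hsR, sub_zero] at h1
    refine h1.trans (mul_le_mul_of_nonneg_left ?_ C.2)
    have : x - z = s • (x - y) := by
      simp only [z, AffineMap.lineMap_apply_module]; module
    rw [this, norm_smul, Real.norm_of_nonneg hs.1]
    exact mul_le_of_le_one_left (norm_nonneg _) hs.2
  refine LipschitzWith.of_dist_le_mul fun x y => ?_
  rw [dist_eq_norm, dist_eq_norm]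
  by_cases hx : x ∈ closedBall (0 : E) R <;> by_cases hy : y ∈ closedBall (0 : E) R
  · rw [indicator_of_mem hx, indicator_of_mem hy]; exact hk.norm_sub_le hx hy
  · rw [indicator_of_mem hx, indicator_of_notMem hy, sub_zero]; exact key x y hx hy
  · rw [indicator_of_notMem hx, indicator_of_mem hy, zero_sub, norm_neg, norm_sub_rev]
    exact key y x hy hx
  · rw [indicator_of_notMem hx, indicator_of_notMem hy, sub_zero, norm_zero]; positivity

/-- There is no `C¹` map into a sphere that fixes the sphere. -/
theorem not_contDiff_retraction_sphere {R : ℝ} (hR : 0 < R) {F : E → E} (hF : ContDiff ℝ 1 F)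
    (hnorm : ∀ x, ‖F x‖ = R) (hfix : ∀ x, ‖x‖ = R → F x = x) : False := by
  classical
  borelize E
  set K := closedBall (0 : E) R with hKdef
  have hK : IsCompact K := isCompact_closedBall _ _
  -- Milnor–Rogers: deform the identity to `F` through `x + t • k₀ x` and follow the volume of the
  -- image of the ball.
  set k₀ : E → E := fun x => F x - x
  have hk₀ : ContDiff ℝ 1 k₀ := hF.sub contDiff_id
  set A : E → E →L[ℝ] E := fderiv ℝ k₀
  have hA : Continuous A := hk₀.continuous_fderiv one_ne_zero
  have hderiv : ∀ x, HasFDerivAt k₀ (A x) x := fun x =>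
    (hk₀.differentiable one_ne_zero x).hasFDerivAt
  obtain ⟨P, hP⟩ := exists_polynomial_setIntegral_det hK hA
  obtain ⟨C, hC⟩ : ∃ C : NNReal, ∀ x ∈ K, ‖A x‖₊ ≤ C := by
    obtain ⟨C, hC⟩ := hK.exists_bound_of_continuousOn hA.continuousOn
    exact ⟨C.toNNReal, fun x hx => NNReal.coe_le_coe.1 ((hC x hx).trans (Real.le_coe_toNNReal C))⟩
  have hlip : LipschitzOnWith C k₀ K := 
    (convex_closedBall _ _).lipschitzOnWith_of_nnnorm_hasFDerivWithin_le (fun x _ => (hderiv x).hasFDerivWithinAt) hC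
  have hglob : LipschitzWith C (K.indicator k₀) :=
    hlip.indicator_closedBall fun x hx => by simp [k₀, hfix x hx]
  set k := K.indicator k₀
  have hdetpos : ∀ᶠ M : E →L[ℝ] E in 𝓝 1, 0 < M.det := by
    have h1 : (1 : E →L[ℝ] E).det = 1 := by
      rw [ContinuousLinearMap.det]; exact LinearMap.det_id
    have h2 : Tendsto (fun M : E →L[ℝ] E => M.det) (𝓝 1) (𝓝 1) := by
      simpa only [h1] using (ContinuousLinearMap.continuous_det (E := E) (𝕜 := ℝ)).tendsto 1
    exact h2.eventually (lt_mem_nhds one_pos)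
  obtain ⟨ε, hε, hεdet⟩ := Metric.eventually_nhds_iff.1 hdetpos
  -- For small `t` the map `f` is a Lipschitz-small perturbation of the identity, hence a bijection
  -- of `E`. It fixes every point off `K`, so it maps `K` onto itself, and the area formula
  -- identifies the integral of its Jacobian with the volume of `K`.
  have hvol : ∀ᶠ t : ℝ in 𝓝[>] 0, P.eval t = (volume K).toReal := by
    have e1 : ∀ᶠ t : ℝ in 𝓝[>] 0, t * C < 1 := by
      have : Tendsto (fun t : ℝ => t * C) (𝓝[>] 0) (𝓝 0) := by
        have h : Continuous fun t : ℝ => t * (C : ℝ) := by fun_prop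
        simpa using (h.tendsto 0).mono_left nhdsWithin_le_nhds
      exact this.eventually (gt_mem_nhds one_pos)
    have e2 : ∀ᶠ t : ℝ in 𝓝[>] 0, t * C < ε := by
      have : Tendsto (fun t : ℝ => t * C) (𝓝[>] 0) (𝓝 0) := by
        have h : Continuous fun t : ℝ => t * (C : ℝ) := by fun_prop
        simpa using (h.tendsto 0).mono_left nhdsWithin_le_nhds
      exact this.eventually (gt_mem_nhds hε)
    filter_upwards [e1, e2, self_mem_nhdsWithin] with t h1 h2 (ht : 0 < t)
    set f : E → E := fun x => x + t • k x
    have happ : ApproximatesLinearOn f ((ContinuousLinearEquiv.refl ℝ E : E ≃L[ℝ] E) : E →L[ℝ] E)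
        univ (t.toNNReal * C) := by
      intro x _ y _
      have : f x - f y - ((ContinuousLinearEquiv.refl ℝ E : E ≃L[ℝ] E) : E →L[ℝ] E) (x - y)
          = t • (k x - k y) := by
        simp only [f, ContinuousLinearEquiv.coe_coe, ContinuousLinearEquiv.refl_apply]; module
      rw [this, norm_smul, Real.norm_of_nonneg ht.le, NNReal.coe_mul, Real.coe_toNNReal _ ht.le,
        mul_assoc]
      exact mul_le_mul_of_nonneg_left (hglob.norm_sub_le x y) ht.le
    have hc : Subsingleton E ∨ t.toNNReal * C < ‖((ContinuousLinearEquiv.refl ℝ E).symm : E →L[ℝ] E)‖₊⁻¹ := by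
      rcases subsingleton_or_nontrivial E with hE | hE
      · exact Or.inl hE
      · right
        have : ‖((ContinuousLinearEquiv.refl ℝ E).symm : E →L[ℝ] E)‖₊ = 1 := by
          apply NNReal.coe_injective
          exact ContinuousLinearMap.norm_id
        rw [this, inv_one, ← NNReal.coe_lt_coe, NNReal.coe_mul, Real.coe_toNNReal _ ht.le]
        exact h1
    have hinj : Function.Injective f := by
      have := happ.injOn hc
      exact injOn_univ.1 this
    have hsurj : Function.Surjective f := happ.surjective hc
    have hout : ∀ x, x ∉ K → f x = x := fun x hx => by
      simp [f, k, indicator_of_notMem hx]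
    have himg : f '' K = K := by
      apply Subset.antisymm
      · rintro _ ⟨x, hx, rfl⟩
        by_contra hfx
        have := hinj (hout _ hfx)
        exact hfx (this.symm ▸ hx)
      · intro y hy
        obtain ⟨x, rfl⟩ := hsurj y
        refine ⟨x, ?_, rfl⟩
        by_contra hx
        rw [hout x hx] at hy
        exact hx hy
    have hfd : ∀ x ∈ K, HasFDerivWithinAt f (1 + t • A x) K x := by
      intro x hx
      have h : HasFDerivWithinAt (fun x => x + t • k₀ x) (1 + t • A x) K x :=
        ((hasFDerivAt_id x).add ((hderiv x).const_smul t)).hasFDerivWithinAt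
      refine h.congr (fun y hy => ?_) ?_
      · simp [f, k, indicator_of_mem hy]
      · simp [f, k, indicator_of_mem hx]
    have hpos : ∀ x ∈ K, 0 < (1 + t • A x).det := by
      intro x hx
      apply hεdet
      rw [dist_eq_norm, add_sub_cancel_left, norm_smul, Real.norm_of_nonneg ht.le]
      exact (mul_le_mul_of_nonneg_left (NNReal.coe_le_coe.2 (hC x hx)) ht.le).trans_lt h2
    have harea := lintegral_abs_det_fderiv_eq_addHaar_image volume hK.measurableSet hfd hinj.injOn
    rw [himg] at harea
    rw [← hP t, ← harea]
    rw [integral_eq_lintegral_of_nonneg_ae]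
    · congr 1
      refine setLIntegral_congr_fun hK.measurableSet fun x hx => ?_
      simp only [abs_of_pos (hpos x hx)]
    · exact (ae_restrict_iff' hK.measurableSet).2 (Eventually.of_forall fun x hx => (hpos x hx).le)
    · refine Continuous.aestronglyMeasurable ?_
      exact ContinuousLinearMap.continuous_det.comp (continuous_const.add (hA.const_smul t))
  -- A polynomial constant on an interval is constant, so the volume identity persists at `t = 1`,
  -- where nothing is known about injectivity.
  have hPC : P = Polynomial.C (volume K).toReal := by
    apply Polynomial.eq_of_infinite_eval_eq
    refine Set.Infinite.mono (s := {t : ℝ | P.eval t = (volume K).toReal}) ?_ ?_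
    · intro t ht; simpa using ht
    · obtain ⟨u, hu, hsub⟩ := mem_nhdsGT_iff_exists_Ioo_subset.1 hvol
      exact (Ioo_infinite hu).mono hsub
  -- At `t = 1` the derivative is that of `F`. Since `‖F‖` is constant, the range of this derivative
  -- is orthogonal to `F x ≠ 0`, so it is singular.
  have hsing : ∀ x, (1 + (1 : ℝ) • A x).det = 0 := by
    intro x
    have hFd : HasFDerivAt F (1 + (1 : ℝ) • A x) x := by
      have := (hasFDerivAt_id (𝕜 := ℝ) x).add (hderiv x)
      rw [one_smul]
      have hFk : F = id + k₀ := by ext y; simp [k₀]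
      rw [hFk]
      exact this
    by_contra hdet
    have hsurj : Function.Surjective (1 + (1 : ℝ) • A x : E →L[ℝ] E) := by
      have := (LinearMap.equivOfDetNeZero ((1 + (1 : ℝ) • A x : E →L[ℝ] E) : E →ₗ[ℝ] E) hdet).surjective
      exact this
    have h2 : HasFDerivAt (fun y => inner ℝ (F y) (F y))
      ((fderivInnerCLM ℝ (F x, F x)).comp ((1 + (1 : ℝ) • A x).prod (1 + (1 : ℝ) • A x))) x := hFd.inner ℝ hFd
    have h3 : HasFDerivAt (fun y => inner ℝ (F y) (F y)) (0 : E →L[ℝ] ℝ) x := by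
      have : (fun y => inner ℝ (F y) (F y)) = fun _ => R ^ 2 := by
        ext y; rw [real_inner_self_eq_norm_sq, hnorm]
      rw [this]; exact hasFDerivAt_const _ _
    have h4 := h2.unique h3
    obtain ⟨v, hv⟩ := hsurj (F x)
    have h5 := DFunLike.congr_fun h4 v
    simp only [ContinuousLinearMap.comp_apply, ContinuousLinearMap.prod_apply, fderivInnerCLM_apply,
      hv, _root_.zero_apply, real_inner_self_eq_norm_sq, hnorm] at h5
    nlinarith [pow_pos hR 2]
  have h1 := hP 1
  rw [hPC, Polynomial.eval_C] at h1
  simp only [hsing, integral_zero] at h1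
  have : 0 < (volume K).toReal :=
    ENNReal.toReal_pos (measure_closedBall_pos volume 0 hR).ne' hK.measure_lt_top.ne
  linarith

/-- A continuous self-map of a Euclidean space that is a translation off a bounded set has a zero. -/
theorem exists_eq_zero_of_eq_sub_of_le_norm {G : E → E} (hG : Continuous G) {p : E} {R : ℝ}
    (hout : ∀ x, R ≤ ‖x‖ → G x = x - p) : ∃ x, G x = 0 := by
  by_contra! hne
  -- Recentring by `p` makes `x + h x = G (x + p)` the identity far out. A nonvanishing `C¹`
  -- approximation of it, normalised to length `R₁ + 1`, would be a retraction onto a sphere.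
  set h : E → E := fun x => G (x + p) - x
  have hh : Continuous h := by fun_prop
  set R₁ : ℝ := |R| + ‖p‖
  have hR₁ : 0 ≤ R₁ := by positivity
  have hh0 : ∀ x, R₁ ≤ ‖x‖ → h x = 0 := by
    intro x hx
    have h1 : ‖x‖ ≤ ‖x + p‖ + ‖p‖ := by simpa using norm_sub_le (x + p) p
    have : G (x + p) = x + p - p := hout _ (by have := le_abs_self R; simp only [R₁] at hx; linarith)
    simp [h, this]
  obtain ⟨δ, hδ, hδle⟩ : ∃ δ > 0, ∀ x ∈ closedBall (0 : E) (R₁ + 1), δ ≤ ‖x + h x‖ := by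
    obtain ⟨x₀, -, hx₀⟩ := (isCompact_closedBall (0 : E) (R₁ + 1)).exists_isMinOn
      ⟨0, mem_closedBall_self (by positivity)⟩
      (f := fun x => ‖x + h x‖) (by fun_prop)
    refine ⟨‖x₀ + h x₀‖, ?_, fun x hx => hx₀ hx⟩
    simpa [h] using hne (x₀ + p)
  classical
  -- The smooth selection from these convex sets is closer to `h` than the minimum `δ`, and exactly
  -- zero from radius `R₁ + 1` on. The local constant is `0` beyond radius `R₁`, where `h` already
  -- vanishes, and `h x` elsewhere.
  let t : E → Set E := fun y => if R₁ + 1 ≤ ‖y‖ then {0} else ball (h y) δ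
  have ht : ∀ x, Convex ℝ (t x) := by
    intro x
    by_cases hx : R₁ + 1 ≤ ‖x‖
    · simp only [t, if_pos hx]; exact convex_singleton _
    · simp only [t, if_neg hx]; exact convex_ball _ _
  obtain ⟨s, hs⟩ := exists_contMDiffMap_forall_mem_convex_of_local_const (n := 1)
    (modelWithCornersSelf ℝ E) ht (by
    intro x
    rcases lt_or_ge R₁ ‖x‖ with hx | hx
    · refine ⟨0, ?_⟩
      filter_upwards [continuous_norm.continuousAt.eventually (lt_mem_nhds hx)] with y hy
      simp only [t]
      split_ifs
      · rfl
      · rw [hh0 y (le_of_lt hy)]; exact mem_ball_self hδ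
    · refine ⟨h x, ?_⟩
      have hx' : ‖x‖ < R₁ + 1 := by linarith
      filter_upwards [continuous_norm.continuousAt.eventually (gt_mem_nhds hx'),
        hh.continuousAt.eventually (ball_mem_nhds _ hδ)] with y hy hy2
      simp only [t]
      rw [if_neg (not_le.2 hy)]
      exact mem_ball_comm.1 hy2)
  have hsd : ContDiff ℝ 1 s := s.contMDiff.contDiff
  set G₂ : E → E := fun x => x + s x
  have hG₂ : ContDiff ℝ 1 G₂ := contDiff_id.add hsd
  have hG₂out : ∀ x, R₁ + 1 ≤ ‖x‖ → G₂ x = x := by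
    intro x hx
    have := hs x
    simp only [t, if_pos hx, mem_singleton_iff] at this
    simp [G₂, this]
  have hG₂ne : ∀ x, G₂ x ≠ 0 := by
    intro x h0
    rcases le_or_gt (R₁ + 1) ‖x‖ with hx | hx
    · rw [hG₂out x hx] at h0
      rw [h0, norm_zero] at hx
      linarith
    · have h1 := hs x
      simp only [t, if_neg (not_le.2 hx), mem_ball, dist_eq_norm] at h1
      have h2 := hδle x (mem_closedBall_zero_iff.2 hx.le)
      have h3 : x + h x = -(s x - h x) := by
        rw [neg_sub, eq_sub_iff_add_eq, add_right_comm]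
        exact (congrArg (· + h x) h0).trans (zero_add _)
      rw [h3, norm_neg] at h2
      linarith
  have hR₂ : 0 < R₁ + 1 := by linarith
  refine not_contDiff_retraction_sphere hR₂
    (F := fun x => ((R₁ + 1) / ‖G₂ x‖) • G₂ x) ?_ ?_ ?_
  · exact (contDiff_const.div (hG₂.norm ℝ hG₂ne) fun x => norm_ne_zero_iff.2 (hG₂ne x)).smul hG₂
  · intro x
    rw [norm_smul, norm_div, norm_norm, Real.norm_of_nonneg hR₂.le,
      div_mul_cancel₀ _ (norm_ne_zero_iff.2 (hG₂ne x))]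
  · intro x hx
    simp only [hG₂out x hx.ge, hx, div_self hR₂.ne', one_smul]

end Euclidean

/-! ### Arcs do not separate. -/

section Separation

variable {E : Type*} [NormedAddCommGroup E] [InnerProductSpace ℝ E] [FiniteDimensional ℝ E]

/-- If neither of two points can be separated from the other by the closed set `B`, witnessed by a
path missing a point `c`, then they cannot be separated by `A ∪ B` either, where `A` is a compact set
contractible in itself to `c` and meeting `B` at most in `c`. -/
theorem mem_connectedComponentIn_compl_union_of_contraction {A B : Set E} (hA : IsCompact A)
    (hB : IsClosed B) (hBb : Bornology.IsBounded Bᶜ) {c : E} (hAB : A ∩ B ⊆ {c}) {κ : E → ℝ → E}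
    (hκ : Continuous (Function.uncurry κ)) (hκ0 : ∀ x ∈ A, κ x 0 = x) (hκ1 : ∀ x ∈ A, κ x 1 = c)
    (hκc : c ∈ A → ∀ s ∈ Icc (0 : ℝ) 1, κ c s = c) (hκA : ∀ x ∈ A, ∀ s ∈ Icc (0 : ℝ) 1, κ x s ∈ A)
    {p q : E} (hp : p ∉ A ∪ B) (hq : q ∉ A ∪ B) (hJ : JoinedIn (B ∪ {c})ᶜ p q) :
    q ∈ connectedComponentIn (A ∪ B)ᶜ p := by
  classical
  by_contra hqU
  have hF : IsClosed (A ∪ B) := hA.isClosed.union hB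
  set F := A ∪ B
  set U := connectedComponentIn Fᶜ p
  have hU : IsOpen U := hF.isOpen_compl.connectedComponentIn
  have hUF : U ⊆ Fᶜ := connectedComponentIn_subset _ _
  have hpU : p ∈ U := mem_connectedComponentIn hp
  have hclU : closure U ⊆ U ∪ F := by
    intro x hx
    by_contra hxn
    rw [mem_union, not_or] at hxn
    have hxF : x ∈ Fᶜ := hxn.2
    obtain ⟨y, hy, hyU⟩ := mem_closure_iff.1 hx _ hF.isOpen_compl.connectedComponentIn
      (mem_connectedComponentIn hxF)
    have := (connectedComponentIn_eq hyU).trans (connectedComponentIn_eq hy).symm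
    exact hxn.1 (this.symm ▸ mem_connectedComponentIn hxF : x ∈ connectedComponentIn Fᶜ p)
  have hfr : frontier U ⊆ F := by
    intro x hx
    rw [hU.frontier_eq] at hx
    exact (hclU hx.1).resolve_left hx.2
  have hUb : Bornology.IsBounded U :=
    hBb.subset (hUF.trans (compl_subset_compl.2 subset_union_right))
  have hqcl : q ∉ closure U := fun h => (hclU h).elim hqU hq
  obtain ⟨γ, hγ⟩ := hJ
  set J : ℝ → E := fun s => γ.extend (3 * s - 1)
  have hJc : Continuous J := γ.continuous_extend.comp (by fun_prop)
  have hJB : ∀ s, J s ∉ B ∪ {c} := by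
    intro s
    have : J s ∈ range γ := by rw [← γ.extend_range]; exact mem_range_self _
    obtain ⟨u, hu⟩ := this
    rw [← hu]; exact hγ u
  have hJ0 : ∀ s ≤ 1 / 3, J s = p := fun s hs => γ.extend_of_le_zero (by linarith)
  have hJ1 : ∀ s, 2 / 3 ≤ s → J s = q := fun s hs => γ.extend_of_one_le (by linarith)
  -- A schedule in three phases: `A` contracts to `c` while the point `J` waits at `p`; `J` travels
  -- to `q` while `A` rests at `c`; `A` expands again while `J` waits at `q`.
  set σ : ℝ → ℝ := fun s => max 0 (min 1 (min (3 * s) (3 - 3 * s)))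
  have hσc : Continuous σ := by fun_prop
  have hσI : ∀ s, σ s ∈ Icc (0 : ℝ) 1 := fun s =>
    ⟨le_max_left _ _, max_le zero_le_one (min_le_left _ _)⟩
  have hσ0 : σ 0 = 0 := by norm_num [σ]
  have hσ1 : σ 1 = 0 := by norm_num [σ]
  have hσm : ∀ s, 1 / 3 ≤ s → s ≤ 2 / 3 → σ s = 1 := by
    intro s h1 h2
    have : min 1 (min (3 * s) (3 - 3 * s)) = 1 := min_eq_left (le_min (by linarith) (by linarith))
    simp [σ, this]
  -- The motion fixes `B` throughout and is required to be the identity of all of `E` at time `1`.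
  -- The prescriptions agree on overlaps because `κ` fixes `c`, so Tietze extends them to `N`.
  set M : E × ℝ → E := fun z => if z.1 ∈ B ∨ z.2 = 1 then z.1 else κ z.1 (σ z.2)
  set S : Set (E × ℝ) := (A ×ˢ Icc 0 1 ∪ B ×ˢ Icc 0 1) ∪ univ ×ˢ {1}
  have hSA : IsClosed (A ×ˢ Icc (0 : ℝ) 1) := hA.isClosed.prod isClosed_Icc
  have hSB : IsClosed (B ×ˢ Icc (0 : ℝ) 1) := hB.prod isClosed_Icc
  have hS1 : IsClosed ((univ : Set E) ×ˢ {(1 : ℝ)}) := isClosed_univ.prod isClosed_singleton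
  have hMA : ∀ z ∈ A ×ˢ Icc (0 : ℝ) 1, M z = κ z.1 (σ z.2) := by
    rintro ⟨x, s⟩ ⟨hx, hs⟩
    simp only [M]
    split_ifs with h
    · rcases h with h | h
      · have : x = c := hAB ⟨hx, h⟩
        subst this
        exact (hκc hx _ (hσI s)).symm
      · have h : s = 1 := h
        rw [h, hσ1, hκ0 x hx]
    · rfl
  have hMS : ContinuousOn M S := by
    refine ((ContinuousOn.congr ?_ hMA).union_of_isClosed (ContinuousOn.congr (f := Prod.fst) ?_ ?_)
      hSA hSB).union_of_isClosed (ContinuousOn.congr (f := Prod.fst) ?_ ?_) (hSA.union hSB) hS1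
    · exact (hκ.comp (continuous_fst.prodMk (hσc.comp continuous_snd))).continuousOn
    · exact continuousOn_fst
    · rintro ⟨x, s⟩ ⟨hx, hs⟩; exact if_pos (Or.inl hx)
    · exact continuousOn_fst
    · rintro ⟨x, s⟩ ⟨hx, hs⟩; exact if_pos (Or.inr hs)
  obtain ⟨N, hN⟩ := ContinuousMap.exists_restrict_eq ((hSA.union hSB).union hS1)
    (⟨S.domRestrict M, hMS.domRestrict⟩ : C(S, E))
  have hNM : ∀ z ∈ S, N z = M z := fun z hz => DFunLike.congr_fun hN ⟨z, hz⟩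
  have hNA : ∀ x ∈ A, ∀ s ∈ Icc (0 : ℝ) 1, N (x, s) = κ x (σ s) := fun x hx s hs => by
    rw [hNM _ (Or.inl (Or.inl ⟨hx, hs⟩)), hMA _ ⟨hx, hs⟩]
  have hNB : ∀ x ∈ B, ∀ s ∈ Icc (0 : ℝ) 1, N (x, s) = x := fun x hx s hs => by
    rw [hNM _ (Or.inl (Or.inr ⟨hx, hs⟩))]; exact if_pos (Or.inl hx)
  have hN1 : ∀ x, N (x, 1) = x := fun x => by
    rw [hNM _ (Or.inr ⟨mem_univ _, mem_singleton _⟩)]; exact if_pos (Or.inr rfl)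
  have hNF0 : ∀ x ∈ F, N (x, 0) = x := by
    rintro x (hx | hx)
    · rw [hNA x hx 0 ⟨le_rfl, zero_le_one⟩, hσ0, hκ0 x hx]
    · exact hNB x hx 0 ⟨le_rfl, zero_le_one⟩
  have hNJ : ∀ x ∈ F, ∀ s ∈ Icc (0 : ℝ) 1, N (x, s) ≠ J s := by
    rintro x (hx | hx) s hs h
    · rw [hNA x hx s hs] at h
      have hmem : J s ∈ A := h ▸ hκA x hx _ (hσI s)
      rcases le_or_gt s (1 / 3) with h1 | h1
      · rw [hJ0 s h1] at hmem; exact hp (Or.inl hmem)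
      rcases le_or_gt (2 / 3) s with h2 | h2
      · rw [hJ1 s h2] at hmem; exact hq (Or.inl hmem)
      rw [hσm s h1.le h2.le, hκ1 x hx] at h
      exact hJB s (Or.inr h.symm)
    · rw [hNB x hx s hs] at h
      exact hJB s (Or.inl (h ▸ hx))
  -- Points of `closure U` that meet `J` at some time. None lies in `F`, since the schedule keeps
  -- `J` off the moving image of `F`; so a Urysohn function `τ` can serve as a clock, reading `0` on
  -- `F` and `1` on `Z`.
  set Z : Set E := Prod.fst '' {z : E × ℝ | z ∈ closure U ×ˢ Icc (0 : ℝ) 1 ∧ N z = J z.2}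
  have hZ : IsClosed Z := by
    have h1 : IsCompact {z : E × ℝ | z ∈ closure U ×ˢ Icc (0 : ℝ) 1 ∧ N z = J z.2} :=
      (hUb.isCompact_closure.prod isCompact_Icc).inter_right
        (isClosed_eq N.continuous (hJc.comp continuous_snd))
    exact (h1.image continuous_fst).isClosed
  have hdisj : Disjoint F Z := by
    rw [Set.disjoint_left]
    rintro _ hx ⟨⟨x, s⟩, ⟨⟨-, hs⟩, h⟩, rfl⟩
    exact hNJ x hx s hs h
  obtain ⟨τ, hτF, hτZ, hτI⟩ := exists_continuous_zero_one_of_isClosed hF hZ hdisj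
  -- The two pieces agree on `frontier U ⊆ F`, where `τ = 0`. A zero off `U` would be `p`, which
  -- lies in `U`; a zero in `U` lies in `Z`, so it is read at time `1` and equals `q`, which is not
  -- in `closure U`.
  set G : E → E := U.piecewise (fun x => N (x, τ x) - J (τ x)) (fun x => x - p)
  have hG : Continuous G := by
    refine Continuous.piecewise ?_ ?_ ?_
    · intro x hx
      have hxF := hfr hx
      have : τ x = 0 := hτF hxF
      rw [this, hNF0 x hxF, hJ0 0 (by norm_num)]
    · exact (N.continuous.comp (continuous_id.prodMk τ.continuous)).sub (hJc.comp τ.continuous)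
    · fun_prop
  obtain ⟨R, hR⟩ := hUb.subset_ball 0
  obtain ⟨x, hx⟩ := exists_eq_zero_of_eq_sub_of_le_norm hG (p := p) (R := R) (by
    intro x hx
    have : x ∉ U := fun h => by
      have := mem_ball_zero_iff.1 (hR h); linarith
    exact piecewise_eq_of_notMem _ _ _ this)
  by_cases hxU : x ∈ U
  · rw [show G x = N (x, τ x) - J (τ x) from piecewise_eq_of_mem _ _ _ hxU, sub_eq_zero] at hx
    have hxZ : x ∈ Z := ⟨(x, τ x), ⟨⟨subset_closure hxU, hτI x⟩, hx⟩, rfl⟩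
    have : τ x = 1 := hτZ hxZ
    rw [this, hN1, hJ1 1 (by norm_num)] at hx
    exact hqcl (hx ▸ subset_closure hxU)
  · rw [show G x = x - p from piecewise_eq_of_notMem _ _ _ hxU, sub_eq_zero] at hx
    exact hxU (hx ▸ hpU)

/-- An arc meeting the closed set `B` at most in its last point does not contribute to separating
two points. -/
theorem mem_connectedComponentIn_compl_range_union {α : C(unitInterval, E)}
    (hα : Function.Injective α) {B : Set E} (hB : IsClosed B) (hBb : Bornology.IsBounded Bᶜ)
    (hαB : ∀ t, α t ∈ B → t = 1) {p q : E} (hp : p ∉ range α ∪ B) (hq : q ∉ range α ∪ B)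
    (hJ : JoinedIn (B ∪ {α 1})ᶜ p q) : q ∈ connectedComponentIn (range α ∪ B)ᶜ p := by
  have hemb : IsClosedEmbedding α := α.continuous.isClosedEmbedding hα
  -- `β` extends the inverse parametrisation of the arc, so the contraction slides the parameter to
  -- `1`.
  obtain ⟨β, hβ⟩ := ContinuousMap.exists_extension hemb (ContinuousMap.id unitInterval)
  have hβ' : ∀ t, β (α t) = t := fun t => DFunLike.congr_fun hβ t
  refine mem_connectedComponentIn_compl_union_of_contraction
    (κ := fun x s => α (projIcc 0 1 zero_le_one ((1 - s) * β x + s)))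
    (isCompact_range α.continuous) hB hBb ?_ ?_ ?_ ?_ ?_ ?_ hp hq hJ
  · rintro _ ⟨⟨t, rfl⟩, ht⟩
    rw [hαB t ht]; rfl
  · refine α.continuous.comp (continuous_projIcc.comp ?_)
    fun_prop
  · rintro _ ⟨t, rfl⟩
    simp [hβ']
  · rintro _ ⟨t, rfl⟩
    simp
  · rintro - s -
    simp [hβ']
  · rintro x - s -
    exact mem_range_self _

omit [FiniteDimensional ℝ E] in
/-- Punctured open connected sets in dimension at least two are connected. -/
theorem isPreconnected_diff_singleton_of_one_lt_rank (hE : 1 < Module.rank ℝ E) {U : Set E}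
    (hU : IsOpen U) (hUc : IsPreconnected U) (c : E) : IsPreconnected (U \ {c}) := by
  by_cases hc : c ∈ U
  swap
  · rwa [sdiff_singleton_eq_self hc]
  obtain ⟨r, hr, hrU⟩ := Metric.isOpen_iff.1 hU c hc
  have hUo : IsOpen (U \ {c}) := hU.sdiff isClosed_singleton
  have hD : IsConnected (ball c r \ {c}) := by
    have : ball c r \ {c} = OpenPartialHomeomorph.univBall c r '' {0}ᶜ := by
      ext y
      constructor
      · rintro ⟨hy, hyc⟩
        have hy' : y ∈ (OpenPartialHomeomorph.univBall c r).target := by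
          rwa [OpenPartialHomeomorph.univBall_target c hr]
        refine ⟨(OpenPartialHomeomorph.univBall c r).symm y, ?_,
          (OpenPartialHomeomorph.univBall c r).right_inv hy'⟩
        intro h0
        apply hyc
        rw [← (OpenPartialHomeomorph.univBall c r).right_inv hy', h0,
          OpenPartialHomeomorph.univBall_apply_zero]
        rfl
      · rintro ⟨x, hx, rfl⟩
        have hxs : ∀ z, z ∈ (OpenPartialHomeomorph.univBall c r).source := fun z => by simp
        refine ⟨?_, fun h => hx ?_⟩
        · rw [← OpenPartialHomeomorph.univBall_target c hr]
          exact (OpenPartialHomeomorph.univBall c r).map_source (hxs x)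
        · apply (OpenPartialHomeomorph.univBall c r).injOn (hxs x) (hxs 0)
          rw [OpenPartialHomeomorph.univBall_apply_zero]
          exact h
    rw [this]
    exact (isConnected_compl_singleton_of_one_lt_rank hE 0).image _
      (OpenPartialHomeomorph.continuous_univBall c r).continuousOn
  obtain ⟨d, hd⟩ := hD.nonempty
  have hDU : ball c r \ {c} ⊆ U \ {c} := sdiff_subset_sdiff_left hrU
  set V := connectedComponentIn (U \ {c}) d
  have hDV : ball c r \ {c} ⊆ V := hD.isPreconnected.subset_connectedComponentIn hd hDU
  have hV₂ : IsOpen ((U \ {c}) \ V) := by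
    rw [isOpen_iff_mem_nhds]
    rintro x ⟨hx, hxV⟩
    refine mem_of_superset (hUo.connectedComponentIn.mem_nhds (mem_connectedComponentIn hx)) ?_
    intro y hy
    refine ⟨connectedComponentIn_subset _ _ hy, fun hyV => hxV ?_⟩
    have := (connectedComponentIn_eq hyV).trans (connectedComponentIn_eq hy).symm
    exact (this.symm ▸ mem_connectedComponentIn hx : x ∈ connectedComponentIn (U \ {c}) d)
  -- Filling in the puncture turns a second component of `U \ {c}` into a separation of `U`, because
  -- the punctured ball lies wholly in `V`.
  have hsub : U ⊆ V ∪ ball c r := by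
    refine hUc.subset_left_of_subset_union (hUo.connectedComponentIn.union isOpen_ball) hV₂ ?_ ?_
      ⟨c, hc, Or.inr (mem_ball_self hr)⟩
    · rw [Set.disjoint_left]
      rintro x (hx | hx) ⟨hx1, hx2⟩
      · exact hx2 hx
      · exact hx2 (hDV ⟨hx, hx1.2⟩)
    · intro x hx
      by_cases hxc : x = c
      · exact Or.inl (Or.inr (hxc ▸ mem_ball_self hr))
      · by_cases hxV : x ∈ V
        · exact Or.inl (Or.inl hxV)
        · exact Or.inr ⟨⟨hx, hxc⟩, hxV⟩
  have : U \ {c} = V := by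
    refine Subset.antisymm (fun x hx => ?_) (connectedComponentIn_subset _ _)
    exact (hsub hx.1).elim id fun h => hDV ⟨h, hx.2⟩
  rw [this]
  exact isPreconnected_connectedComponentIn

/-- An arc does not separate a bounded open connected set containing it. -/
theorem isPreconnected_diff_range_arc (hE : 1 < Module.rank ℝ E) {α : C(unitInterval, E)}
    (hα : Function.Injective α) {U : Set E} (hU : IsOpen U) (hUc : IsPreconnected U)
    (hUb : Bornology.IsBounded U) (hαU : range α ⊆ U) : IsPreconnected (U \ range α) := by
  have hset : (range α ∪ Uᶜ)ᶜ = U \ range α := by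
    rw [compl_union, compl_compl, inter_comm]; rfl
  refine isPreconnected_of_forall_pair fun p hp q hq =>
    ⟨connectedComponentIn (U \ range α) p, connectedComponentIn_subset _ _,
      mem_connectedComponentIn hp, ?_, isPreconnected_connectedComponentIn⟩
  have hp' : p ∈ (range α ∪ Uᶜ)ᶜ := hset ▸ hp
  have hq' : q ∈ (range α ∪ Uᶜ)ᶜ := hset ▸ hq
  rw [← hset]
  -- With `B = Uᶜ` the arc misses `B` altogether; what remains is to join the two points in `U`
  -- punctured at `α 1`.
  refine mem_connectedComponentIn_compl_range_union hα hU.isClosed_compl (by rwa [compl_compl])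
    (fun t ht => absurd (hαU (mem_range_self t)) ht) hp' hq' ?_
  have hset' : (Uᶜ ∪ {α 1})ᶜ = U \ {α 1} := by
    rw [compl_union, compl_compl]; rfl
  rw [hset']
  have hne : ∀ x ∈ U \ range α, x ∈ U \ {α 1} := fun x hx =>
    ⟨hx.1, fun h => hx.2 (h ▸ mem_range_self _)⟩
  have hconn : IsConnected (U \ {α 1}) :=
    ⟨⟨p, hne p hp⟩, isPreconnected_diff_singleton_of_one_lt_rank hE hU hUc _⟩
  exact ((hU.sdiff isClosed_singleton).isConnected_iff_isPathConnected.1 hconn).joinedIn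
    p (hne p hp) q (hne q hq)

/-- An arc does not separate small neighbourhoods of its first point. -/
theorem exists_ball_forall_mem_connectedComponentIn_ball_diff_range_arc {α : C(unitInterval, E)}
    (hα : Function.Injective α) {ε : ℝ} (hε : 0 < ε) :
    ∃ δ > 0, ∀ p ∈ ball (α 0) δ \ range α, ∀ q ∈ ball (α 0) δ \ range α,
      q ∈ connectedComponentIn (ball (α 0) ε \ range α) p := by
  obtain ⟨ρ, hρ, hρα⟩ := Metric.continuousAt_iff.1 (α.continuous.continuousAt (x := 0)) ε hε
  obtain ⟨u, hu0, huρ⟩ : ∃ u : unitInterval, 0 < u ∧ (u : ℝ) < ρ :=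
    ⟨⟨min (ρ / 2) 1, by positivity, min_le_right _ _⟩,
      Subtype.coe_lt_coe.1 (lt_min (by positivity) one_pos),
      (min_le_left _ _).trans_lt (by linarith)⟩
  have hu0' : (0 : ℝ) < u := hu0
  have hball : ∀ t ≤ u, α t ∈ ball (α 0) ε := by
    intro t ht
    refine hρα ?_
    rw [Subtype.dist_eq, Real.dist_eq, Icc.coe_zero, sub_zero, abs_of_nonneg t.2.1]
    exact (Subtype.coe_le_coe.2 ht).trans_lt huρ
  have hC : IsClosed (α '' Ici u) := (isClosed_Ici.isCompact.image α.continuous).isClosed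
  have h0C : α 0 ∈ (α '' Ici u)ᶜ := by
    rintro ⟨t, ht, h⟩
    rw [hα h] at ht
    exact absurd hu0 (not_lt.2 ht)
  obtain ⟨δ, hδ, hδC⟩ := Metric.isOpen_iff.1 hC.isOpen_compl _ h0C
  -- Only the initial piece up to `α u`, which stays in the `ε`-ball, is contracted. The rest of the
  -- arc joins `B` and meets this piece just at `α u`. The `δ`-ball avoids that rest, so points in
  -- the smaller ball can be joined by segments.
  set B := α '' Ici u ∪ (ball (α 0) ε)ᶜ
  let α₁ : C(unitInterval, E) := ⟨fun t => α (u * t), by fun_prop⟩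
  have hα₁ : Function.Injective α₁ := by
    intro s t h
    have h2 : ((u * s : unitInterval) : ℝ) = (u * t : unitInterval) := congrArg _ (hα h)
    exact Subtype.ext (mul_left_cancel₀ hu0'.ne' h2)
  have hle : ∀ t, u * t ≤ u := fun t => Subtype.coe_le_coe.1 (mul_le_of_le_one_right hu0'.le t.2.2)
  have hα₁B : ∀ t, α₁ t ∈ B → t = 1 := by
    rintro t (⟨s, hs, h⟩ | h)
    · have h2 : s = u * t := hα h
      subst h2
      have h3 : (u : ℝ) ≤ u * t := hs
      exact Subtype.ext (le_antisymm t.2.2 (le_of_mul_le_mul_left (by simpa using h3) hu0'))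
    · exact absurd (hball _ (hle t)) h
  have hset : (range α₁ ∪ B)ᶜ = ball (α 0) ε \ range α := by
    have h1 : range α₁ ∪ α '' Ici u = range α := by
      apply Subset.antisymm
      · rintro _ (⟨t, rfl⟩ | ⟨t, -, rfl⟩) <;> exact mem_range_self _
      · rintro _ ⟨t, rfl⟩
        rcases le_total u t with h | h
        · exact Or.inr ⟨t, h, rfl⟩
        · refine Or.inl ⟨⟨t / u, div_nonneg t.2.1 u.2.1, div_le_one_of_le₀ h u.2.1⟩, ?_⟩
          exact congrArg α (Subtype.ext (mul_div_cancel₀ (t : ℝ) hu0'.ne'))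
    rw [← union_assoc, h1, compl_union, compl_compl, inter_comm]; rfl
  have hBb : Bornology.IsBounded Bᶜ := by
    refine (isBounded_ball (x := α 0) (r := ε)).subset ?_
    rw [compl_union, compl_compl]; exact inter_subset_right
  refine ⟨min δ ε, lt_min hδ hε, fun p hp q hq => ?_⟩
  have hsub : ball (α 0) (min δ ε) \ range α ⊆ (range α₁ ∪ B)ᶜ := by
    rw [hset]; exact sdiff_subset_sdiff_left (ball_subset_ball (min_le_right _ _))
  have hα₁1 : α₁ 1 = α u := congrArg α (mul_one u)
  rw [← hset]
  refine mem_connectedComponentIn_compl_range_union hα₁ (hC.union isOpen_ball.isClosed_compl) hBb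
    hα₁B (hsub hp) (hsub hq) ?_
  refine (((convex_ball (α 0) (min δ ε)).isPathConnected ⟨p, hp.1⟩).joinedIn p hp.1 q hq.1).mono ?_
  intro x hx
  have hxδ := ball_subset_ball (min_le_left _ _) hx
  have hxε := ball_subset_ball (min_le_right _ _) hx
  rintro ((h | h) | h)
  · exact hδC hxδ h
  · exact h hxε
  · refine hδC hxδ ?_
    rw [mem_singleton_iff.1 h, hα₁1]
    exact mem_image_of_mem _ self_mem_Ici

omit [FiniteDimensional ℝ E] in
/-- In dimension at least two, arcs have empty interior. -/
theorem interior_range_arc (hE : 1 < Module.rank ℝ E) {α : C(unitInterval, E)}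
    (hα : Function.Injective α) : interior (range α) = ∅ := by
  have : Nontrivial E := (rank_pos_iff_nontrivial (R := ℝ)).1 (zero_lt_one.trans hE)
  by_contra hne
  obtain ⟨x, hx⟩ := nonempty_iff_ne_empty.2 hne
  obtain ⟨r, hr, hrα⟩ := Metric.isOpen_iff.1 isOpen_interior x hx
  replace hrα := hrα.trans interior_subset
  have hemb : IsClosedEmbedding α := α.continuous.isClosedEmbedding hα
  -- A ball stays connected after removing a point, whereas removing `α v` would leave a gap between
  -- parameters `u < v < w`.
  have hpre : ∀ c, IsPreconnected (α ⁻¹' (ball x r \ {c})) := fun c => by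
    refine (hemb.isInducing.isPreconnected_image).1 ?_
    rw [image_preimage_eq_of_subset (sdiff_subset.trans hrα)]
    exact isPreconnected_diff_singleton_of_one_lt_rank hE isOpen_ball isPreconnected_ball c
  have hinf : (α ⁻¹' ball x r).Infinite := by
    intro hfin
    have := hfin.image α
    rw [image_preimage_eq_of_subset hrα] at this
    exact (infinite_of_mem_nhds x (ball_mem_nhds x hr)) this
  obtain ⟨F, hF, hcard⟩ := hinf.exists_subset_card_eq 3
  obtain ⟨u, v, w, huv, hvw, hu, hv, hw⟩ : ∃ u v w, u < v ∧ v < w ∧ u ∈ F ∧ v ∈ F ∧ w ∈ F := by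
    let e := F.orderEmbOfFin hcard
    exact ⟨e 0, e 1, e 2, e.lt_iff_lt.2 (by decide), e.lt_iff_lt.2 (by decide),
      F.orderEmbOfFin_mem hcard _, F.orderEmbOfFin_mem hcard _, F.orderEmbOfFin_mem hcard _⟩
  have hord := (hpre (α v)).ordConnected.out
    (x := u) ⟨hF hu, fun h => huv.ne (hα h)⟩ (y := w) ⟨hF hw, fun h => hvw.ne' (hα h)⟩
  exact (hord ⟨huv.le, hvw.le⟩).2 rfl

end Separation

/-! ### Chains of balls and their pruning to simple chains. -/

section Chains

theorem Nat.exists_last {P : ℕ → Prop} {m : ℕ} (hm : P m) (hP : ∀ᶠ j in atTop, ¬ P j) :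
    ∃ j, m ≤ j ∧ P j ∧ ∀ l, j < l → ¬ P l := by
  classical
  obtain ⟨N, hN⟩ := eventually_atTop.1 hP
  have hmN : m ≤ N := by
    by_contra h
    exact hN m (le_of_not_ge h) hm
  refine ⟨Nat.findGreatest P N, Nat.le_findGreatest hmN hm, Nat.findGreatest_spec hmN hm,
    fun l hl => ?_⟩
  rcases le_total l N with h | h
  · exact Nat.findGreatest_is_greatest hl h
  · exact hN l h

theorem Relation.TransGen.exists_seq {X : Type*} {r : X → X → Prop} {a b : X}
    (h : Relation.TransGen r a b) :
    ∃ (n : ℕ) (c : ℕ → X), c 0 = a ∧ c (n + 1) = b ∧ ∀ i ≤ n, r (c i) (c (i + 1)) := by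
  induction h using Relation.TransGen.head_induction_on with
  | @single a h =>
    refine ⟨0, fun i => if i = 0 then a else b, by simp, by simp, fun i hi => ?_⟩
    obtain rfl := Nat.le_zero.1 hi
    simpa using h
  | @head a d h _ ih =>
    obtain ⟨n, c, h0, h1, hc⟩ := ih
    refine ⟨n + 1, fun i => Nat.casesOn i a c, rfl, h1, fun i hi => ?_⟩
    cases i with
    | zero => simpa [h0] using h
    | succ i => exact hc i (by omega)

/-- Concatenation of infinitely many finite chains. -/
theorem exists_seq_of_forall_transGen {X : Type*} {r : ℕ → X → X → Prop} {p : ℕ → X}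
    (h : ∀ k, Relation.TransGen (r k) (p k) (p (k + 1))) :
    ∃ (y : ℕ → X) (κ : ℕ → ℕ), y 0 = p 0 ∧ Tendsto κ atTop atTop ∧
      ∀ i, r (κ i) (y i) (y (i + 1)) := by
  choose n c hc0 hc1 hc using fun k => (h k).exists_seq
  -- A state is a chain and a position in it. Chain `k` has `n k + 1` links; its last point is the
  -- first point of chain `k + 1`, so position `n k + 1` is skipped.
  let next : ℕ × ℕ → ℕ × ℕ := fun s => if s.2 < n s.1 then (s.1, s.2 + 1) else (s.1 + 1, 0)
  let s : ℕ → ℕ × ℕ := fun i => next^[i] (0, 0)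
  have hs : ∀ i, s (i + 1) = next (s i) := fun i => Function.iterate_succ_apply' _ _ _
  have hinv : ∀ i, (s i).2 ≤ n (s i).1 := by
    intro i
    induction i with
    | zero => exact Nat.zero_le _
    | succ i ih =>
      rw [hs]
      simp only [next]
      split_ifs with hlt
      · exact hlt
      · exact Nat.zero_le _
  have hmono : Monotone fun i => (s i).1 := by
    refine monotone_nat_of_le_succ fun i => ?_
    rw [hs]
    simp only [next]
    split_ifs
    · exact le_rfl
    · exact Nat.le_succ _
  have hreach : ∀ k, ∃ i, s i = (k, 0) := by
    intro k
    induction k with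
    | zero => exact ⟨0, rfl⟩
    | succ k ih =>
      obtain ⟨i, hi⟩ := ih
      have hj : ∀ j ≤ n k, s (i + j) = (k, j) := by
        intro j
        induction j with
        | zero => intro _; exact hi
        | succ j ihj =>
          intro hj
          rw [← add_assoc, hs, ihj (by omega)]
          exact if_pos (Nat.lt_of_succ_le hj)
      refine ⟨i + n k + 1, ?_⟩
      rw [hs, hj _ le_rfl]
      exact if_neg (lt_irrefl _)
  refine ⟨fun i => c (s i).1 (s i).2, fun i => (s i).1, hc0 0,
    tendsto_atTop_atTop_of_monotone hmono fun k => ?_, fun i => ?_⟩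
  · obtain ⟨i, hi⟩ := hreach k
    exact ⟨i, by rw [hi]⟩
  · have h1 := hc (s i).1 (s i).2 (hinv i)
    simp only [hs i, next]
    split_ifs with hlt
    · exact h1
    · have h2 : (s i).2 = n (s i).1 := le_antisymm (hinv i) (not_lt.1 hlt)
      rw [h2] at h1 ⊢
      simpa only [hc0, hc1] using h1

/-- A locally finite sequence of consecutively intersecting sets has a subsequence forming a simple
chain. -/
theorem exists_strictMono_simple_chain {X : Type*} {D : ℕ → Set X}
    (hD : ∀ i, ¬ Disjoint (D i) (D (i + 1))) (hfin : ∀ i, ∀ᶠ j in atTop, Disjoint (D i) (D j)) :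
    ∃ φ : ℕ → ℕ, StrictMono φ ∧ φ 0 = 0 ∧ (∀ k, ¬ Disjoint (D (φ k)) (D (φ (k + 1)))) ∧
      ∀ k l, k + 2 ≤ l → Disjoint (D (φ k)) (D (φ l)) := by
  -- Greedy pruning: jump to the last set that meets the current one, so every later set is disjoint
  -- from it.
  have hnext : ∀ i, ∃ j, i + 1 ≤ j ∧ ¬ Disjoint (D i) (D j) ∧
      ∀ l, j < l → ¬ ¬ Disjoint (D i) (D l) := fun i =>
    Nat.exists_last (hD i) ((hfin i).mono fun _ h => not_not.2 h)
  choose next hlt hmeet hlast using hnext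
  let φ : ℕ → ℕ := fun k => next^[k] 0
  have hφ : ∀ k, φ (k + 1) = next (φ k) := fun k => Function.iterate_succ_apply' _ _ _
  have hmono : StrictMono φ := strictMono_nat_of_lt_succ fun k => by rw [hφ]; exact hlt _
  refine ⟨φ, hmono, rfl, fun k => ?_, fun k l hkl => ?_⟩
  · rw [hφ]; exact hmeet _
  · refine not_not.1 (hlast (φ k) (φ l) ?_)
    rw [← hφ]
    exact hmono (by omega)

/-- Two locally finite sequences of consecutively intersecting sets, starting from intersecting
sets, contain a simple chain indexed by the integers. -/
theorem exists_int_simple_chain {X : Type*} {u w : ℕ → Set X}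
    (hu : ∀ i, ¬ Disjoint (u i) (u (i + 1))) (hw : ∀ i, ¬ Disjoint (w i) (w (i + 1)))
    (hufin : ∀ i, ∀ᶠ j in atTop, Disjoint (u i) (u j))
    (hwfin : ∀ i, ∀ᶠ j in atTop, Disjoint (w i) (w j)) (huw : ¬ Disjoint (u 0) (w 0))
    (huwfin : ∀ᶠ j in atTop, ∀ i, Disjoint (u j) (w i))
    (hwufin : ∀ j, ∀ᶠ i in atTop, Disjoint (u j) (w i)) :
    ∃ (C : ℤ → Set X) (μ ν : ℕ → ℕ), StrictMono μ ∧ StrictMono ν ∧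
      (∀ n : ℕ, C n = w (ν n)) ∧ (∀ n : ℕ, C (Int.negSucc n) = u (μ n)) ∧
      (∀ i, ¬ Disjoint (C i) (C (i + 1))) ∧ ∀ i j, i + 2 ≤ j → Disjoint (C i) (C j) := by
  -- Join the two rays at their last contact: `u j` is the last `u` meeting any `w`, and `w i` the
  -- last `w` meeting `u j`. Only the tails from `j` and `i` are kept.
  obtain ⟨j, -, ⟨i₀, hi₀⟩, hj⟩ := Nat.exists_last (P := fun j => ∃ i, ¬ Disjoint (u j) (w i))
    (m := 0) ⟨0, huw⟩ (huwfin.mono fun j h => by push Not; exact h)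
  obtain ⟨i, -, hi, hilast⟩ := Nat.exists_last (P := fun i => ¬ Disjoint (u j) (w i)) hi₀
    ((hwufin j).mono fun _ h => not_not.2 h)
  push Not at hj hilast
  obtain ⟨φ, hφ, hφ0, hφm, hφd⟩ := exists_strictMono_simple_chain (D := fun k => u (j + k))
    (fun k => hu (j + k)) fun k => (tendsto_add_atTop_nat j).eventually (hufin (j + k)) |>.mono
      fun l hl => by rwa [add_comm j l]
  obtain ⟨ψ, hψ, hψ0, hψm, hψd⟩ := exists_strictMono_simple_chain (D := fun k => w (i + k))
    (fun k => hw (i + k)) fun k => (tendsto_add_atTop_nat i).eventually (hwfin (i + k)) |>.mono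
      fun l hl => by rwa [add_comm i l]
  have hpos : ∀ {f : ℕ → ℕ}, StrictMono f → ∀ {n}, 0 < n → 0 < f n := fun hf n hn =>
    (Nat.zero_le _).trans_lt (hf hn)
  let C : ℤ → Set X := fun z => Int.casesOn z (fun n => w (i + ψ n)) fun n => u (j + φ n)
  have hCp : ∀ n : ℕ, C n = w (i + ψ n) := fun _ => rfl
  have hCn : ∀ n : ℕ, C (Int.negSucc n) = u (j + φ n) := fun _ => rfl
  refine ⟨C, fun n => j + φ n, fun n => i + ψ n, hφ.const_add j, hψ.const_add i, hCp, hCn, ?_, ?_⟩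
  · rintro (n | n)
    · exact hψm n
    · cases n with
      | zero =>
        change ¬ Disjoint (u (j + φ 0)) (w (i + ψ 0))
        rw [hφ0, hψ0]
        exact hi
      | succ n =>
        have : Int.negSucc (n + 1) + 1 = Int.negSucc n := by omega
        rw [this, hCn, hCn, disjoint_comm]
        exact hφm n
  · rintro (m | m) (n | n) h
    · exact hψd m n (by simp only [Int.ofNat_eq_natCast] at h; omega)
    · simp only [Int.ofNat_eq_natCast] at h; omega
    · change Disjoint (u (j + φ m)) (w (i + ψ n))
      rcases Nat.eq_zero_or_pos m with rfl | hm
      · have hn : 0 < n := by simp only [Int.ofNat_eq_natCast] at h; omega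
        rw [hφ0]
        exact hilast _ (by have := hpos hψ hn; omega)
      · exact hj _ (by have := hpos hφ hm; omega) _
    · exact (hφd n m (by omega)).symm

variable {E : Type*} [NormedAddCommGroup E] [InnerProductSpace ℝ E]

omit [InnerProductSpace ℝ E] in
/-- Two points of a connected open set are linked by a finite chain of closed balls in it. -/
theorem transGen_ball_of_mem_connectedComponentIn {W : Set E} (hW : IsOpen W) {p q : E}
    (hq : q ∈ connectedComponentIn W p) :
    Relation.TransGen (fun x y => ∃ c r, closedBall c r ⊆ W ∧ x ∈ ball c r ∧ y ∈ ball c r) p q := by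
  have hp : p ∈ W := by
    by_contra hp
    rw [connectedComponentIn_eq_empty hp] at hq
    exact hq
  refine (isPreconnected_connectedComponentIn (F := W) (x := p)).induction₂' _ (fun x hx => ?_)
    (fun x y z _ _ _ h1 h2 => h1.trans h2) (mem_connectedComponentIn hp) hq
  obtain ⟨r, hr, hrW⟩ := Metric.nhds_basis_closedBall.mem_iff.1
    (hW.mem_nhds (connectedComponentIn_subset _ _ hx))
  filter_upwards [mem_nhdsWithin_of_mem_nhds (ball_mem_nhds x hr)] with y hy
  exact ⟨.single ⟨x, r, hrW, mem_ball_self hr, hy⟩, .single ⟨x, r, hrW, hy, mem_ball_self hr⟩⟩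

variable [FiniteDimensional ℝ E]

/-- A sequence of consecutively intersecting balls in the complement of an arc, converging to its
first point. -/
theorem exists_ball_seq_tendsto_endpoint (hE : 1 < Module.rank ℝ E) {α : C(unitInterval, E)}
    (hα : Function.Injective α) {U : Set E} (hU : IsOpen U) (hUc : IsPreconnected U)
    (hUb : Bornology.IsBounded U) (hαU : range α ⊆ U) {q : E} (hq : q ∈ U \ range α) :
    ∃ D : ℕ → Set E, (∀ i, IsOpen (D i)) ∧ (∀ i, Convex ℝ (D i)) ∧
      (∀ i, closure (D i) ⊆ U \ range α) ∧ q ∈ D 0 ∧ (∀ i, ¬ Disjoint (D i) (D (i + 1))) ∧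
      ∀ ε > 0, ∀ᶠ i in atTop, D i ⊆ ball (α 0) ε := by
  have hcl : IsClosed (range α) := (isCompact_range α.continuous).isClosed
  obtain ⟨ε₀, hε₀, hε₀U⟩ := Metric.isOpen_iff.1 hU (α 0) (hαU (mem_range_self 0))
  set ε : ℕ → ℝ := fun k => ε₀ / (k + 1)
  have hε : ∀ k, 0 < ε k := fun k => by positivity
  have hεle : ∀ k, ε k ≤ ε₀ := fun k => div_le_self hε₀.le (by linarith [Nat.cast_nonneg (α := ℝ) k])
  choose δ hδ hδc using fun k =>
    exists_ball_forall_mem_connectedComponentIn_ball_diff_range_arc hα (hε k)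
  -- Both radii are needed: `x k` and `x (k + 1)` must lie in the common ball of radius `δ k` to be
  -- joined inside the `ε k`-ball. Such points exist because the arc has empty interior.
  have hex : ∀ k : ℕ, ∃ x, x ∈ ball (α 0) (min (min (δ k) (δ (k - 1))) ε₀) \ range α := by
    intro k
    by_contra! h
    have hsub : ball (α 0) (min (min (δ k) (δ (k - 1))) ε₀) ⊆ range α := fun x hx => by
      by_contra hn; exact h x ⟨hx, hn⟩
    have h1 := interior_maximal hsub isOpen_ball
    rw [interior_range_arc hE hα] at h1
    exact h1 (mem_ball_self (lt_min (lt_min (hδ _) (hδ _)) hε₀))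
  choose x hx hxα using hex
  let p : ℕ → E := fun k => Nat.casesOn k q x
  let W : ℕ → Set E := fun k => Nat.casesOn k (U \ range α) fun k => ball (α 0) (ε k) \ range α
  have hWU : ∀ k, W k ⊆ U \ range α := by
    rintro (_ | k)
    · exact Subset.rfl
    · exact sdiff_subset_sdiff_left ((ball_subset_ball (hεle k)).trans hε₀U)
  have hchain : ∀ k, Relation.TransGen
      (fun x y => ∃ c r, closedBall c r ⊆ W k ∧ x ∈ ball c r ∧ y ∈ ball c r) (p k) (p (k + 1)) := by
    rintro (_ | k)
    · refine transGen_ball_of_mem_connectedComponentIn (hU.sdiff hcl) ?_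
      refine (isPreconnected_diff_range_arc hE hα hU hUc hUb hαU).subset_connectedComponentIn hq
        Subset.rfl ⟨hε₀U (ball_subset_ball (min_le_right _ _) (hx 0)), hxα 0⟩
    · refine transGen_ball_of_mem_connectedComponentIn (isOpen_ball.sdiff hcl) (hδc k _ ⟨?_, hxα k⟩ _ ⟨?_, hxα (k + 1)⟩)
      · exact ball_subset_ball ((min_le_left _ _).trans (min_le_left _ _)) (hx k)
      · exact ball_subset_ball ((min_le_left _ _).trans (min_le_right _ _)) (hx (k + 1))
  obtain ⟨y, κ, hy0, hκ, hy⟩ := exists_seq_of_forall_transGen hchain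
  choose c r hcW hcy hcy' using hy
  refine ⟨fun i => ball (c i) (r i), fun i => isOpen_ball, fun i => convex_ball _ _,
    fun i => (closure_ball_subset_closedBall.trans (hcW i)).trans (hWU _), ?_, fun i => ?_, ?_⟩
  · have : y 0 = q := hy0
    exact this ▸ hcy 0
  · exact Set.not_disjoint_iff.2 ⟨y (i + 1), hcy' i, hcy (i + 1)⟩
  · intro η hη
    obtain ⟨K, hK⟩ := exists_nat_gt (ε₀ / η)
    filter_upwards [hκ.eventually (eventually_ge_atTop (K + 1))] with i hi
    obtain ⟨m, hm⟩ : ∃ m, κ i = m + 1 := ⟨κ i - 1, by omega⟩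
    have h1 : W (κ i) ⊆ ball (α 0) (ε m) := by rw [hm]; exact sdiff_subset
    refine (ball_subset_closedBall.trans (hcW i)).trans (h1.trans (ball_subset_ball ?_))
    have h2 : (K : ℝ) ≤ m := by exact_mod_cast (by omega : K ≤ m)
    rw [div_le_iff₀ (by positivity)]
    rw [div_lt_iff₀ hη] at hK
    nlinarith

/-- An arc in an open set can be closed up by a simple chain of convex open sets. -/
theorem exists_int_simple_chain_closing_arc (hE : 1 < Module.rank ℝ E) {α : C(unitInterval, E)}
    (hα : Function.Injective α) {Ω : Set E} (hΩ : IsOpen Ω) (hαΩ : range α ⊆ Ω) :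
    ∃ C : ℤ → Set E, (∀ i, IsOpen (C i)) ∧ (∀ i, Convex ℝ (C i)) ∧ (∀ i, C i ⊆ Ω \ range α) ∧
      (∀ i, ¬ Disjoint (C i) (C (i + 1))) ∧ (∀ i j, i + 2 ≤ j → Disjoint (C i) (C j)) ∧
      (∀ ε > 0, ∀ᶠ i in atTop, C i ⊆ ball (α 0) ε) ∧
      ∀ ε > 0, ∀ᶠ i in atBot, C i ⊆ ball (α 1) ε := by
  obtain ⟨R, hR⟩ := (isCompact_range α.continuous).isBounded.subset_ball 0
  have hΩR : IsOpen (Ω ∩ ball 0 R) := hΩ.inter isOpen_ball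
  set U := connectedComponentIn (Ω ∩ ball 0 R) (α 0)
  have hU : IsOpen U := hΩR.connectedComponentIn
  have hUc : IsPreconnected U := isPreconnected_connectedComponentIn
  have hUΩ : U ⊆ Ω ∩ ball 0 R := connectedComponentIn_subset _ _
  have hUb : Bornology.IsBounded U := isBounded_ball.subset (hUΩ.trans inter_subset_right)
  have hαU : range α ⊆ U := (isPreconnected_range α.continuous).subset_connectedComponentIn
    (mem_range_self 0) (subset_inter hαΩ hR)
  obtain ⟨q, hq⟩ : (U \ range α).Nonempty := by
    by_contra h
    rw [not_nonempty_iff_eq_empty, sdiff_eq_empty] at h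
    have h1 := interior_maximal h hU
    rw [interior_range_arc hE hα] at h1
    exact h1 (hαU (mem_range_self 0))
  let α' : C(unitInterval, E) := α.comp ⟨unitInterval.symm, unitInterval.continuous_symm⟩
  have hα' : Function.Injective α' := hα.comp unitInterval.symm_bijective.injective
  have hr : range α' = range α := unitInterval.symm_bijective.surjective.range_comp α
  have hα'0 : α' 0 = α 1 := congrArg α unitInterval.symm_zero
  obtain ⟨w, hwo, hwc, hwU, hqw, hw, hwlim⟩ :=
    exists_ball_seq_tendsto_endpoint hE hα hU hUc hUb hαU hq
  obtain ⟨u, huo, huc, huU, hqu, hu, hulim⟩ :=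
    exists_ball_seq_tendsto_endpoint hE hα' hU hUc hUb (hr.symm ▸ hαU) (hr.symm ▸ hq)
  rw [hr] at huU
  rw [hα'0] at hulim
  -- The closure of each set misses the arc, hence a neighbourhood of the end point to which the
  -- other sequence shrinks.
  have hfin : ∀ {D D' : ℕ → Set E} {t : unitInterval}, (∀ i, closure (D i) ⊆ U \ range α) →
      (∀ ε > 0, ∀ᶠ i in atTop, D' i ⊆ ball (α t) ε) → ∀ i, ∀ᶠ j in atTop, Disjoint (D i) (D' j) := by
    intro D D' t hD hlim i
    have ht : α t ∈ (closure (D i))ᶜ := fun h => (hD i h).2 (mem_range_self t)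
    obtain ⟨η, hη, hηD⟩ := Metric.isOpen_iff.1 isClosed_closure.isOpen_compl _ ht
    filter_upwards [hlim η hη] with j hj
    exact Set.disjoint_left.2 fun z hz hz' => hηD (hj hz') (subset_closure hz)
  -- Late members of both sequences lie in disjoint balls around the two end points; only finitely
  -- many early `w i` remain.
  have huwfin : ∀ᶠ j in atTop, ∀ i, Disjoint (u j) (w i) := by
    have hne : 0 < dist (α 1) (α 0) := dist_pos.2 fun h => by
      have := hα h
      exact one_ne_zero this
    obtain ⟨N, hN⟩ := eventually_atTop.1 (hwlim (dist (α 1) (α 0) / 2) (by positivity))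
    have hsmall : ∀ᶠ j in atTop, ∀ i ∈ Finset.range N, Disjoint (u j) (w i) :=
      (Finset.eventually_all _).2 fun i _ => (hfin hwU hulim i).mono fun j hj => hj.symm
    filter_upwards [hulim (dist (α 1) (α 0) / 2) (by positivity), hsmall] with j hj hj' i
    rcases lt_or_ge i N with hi | hi
    · exact hj' i (Finset.mem_range.2 hi)
    · exact (ball_disjoint_ball (by linarith)).mono hj (hN i hi)
  obtain ⟨C, μ, ν, hμ, hν, hCw, hCu, hCm, hCd⟩ := exists_int_simple_chain hu hw (hfin huU hulim)
    (hfin hwU hwlim) (Set.not_disjoint_iff.2 ⟨q, hqu, hqw⟩) huwfin (hfin huU hwlim)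
  have hall : ∀ {P : Set E → Prop}, (∀ i, P (u i)) → (∀ i, P (w i)) → ∀ i, P (C i) := by
    rintro P h1 h2 (n | n)
    · exact (hCw n).symm ▸ h2 _
    · exact (hCu n).symm ▸ h1 _
  refine ⟨C, hall huo hwo, hall huc hwc, hall (P := fun s => s ⊆ Ω \ range α)
    (fun i => (subset_closure.trans (huU i)).trans ?_)
    (fun i => (subset_closure.trans (hwU i)).trans ?_), hCm, hCd, fun ε hε => ?_, fun ε hε => ?_⟩
  · exact sdiff_subset_sdiff_left (hUΩ.trans inter_subset_left)
  · exact sdiff_subset_sdiff_left (hUΩ.trans inter_subset_left)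
  · obtain ⟨N, hN⟩ := eventually_atTop.1 (hν.tendsto_atTop.eventually (hwlim ε hε))
    filter_upwards [eventually_ge_atTop (N : ℤ)] with i hi
    obtain ⟨n, rfl⟩ := Int.eq_ofNat_of_zero_le ((Int.natCast_nonneg N).trans hi)
    rw [hCw]
    exact hN n (by exact_mod_cast hi)
  · obtain ⟨N, hN⟩ := eventually_atTop.1 (hμ.tendsto_atTop.eventually (hulim ε hε))
    filter_upwards [eventually_le_atBot (Int.negSucc N)] with i hi
    obtain ⟨n, rfl⟩ : ∃ n, i = Int.negSucc n := Int.eq_negSucc_of_lt_zero (by omega)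
    rw [hCu]
    exact hN n (by omega)

end Chains

/-! ### Smooth regular curves through simple chains of convex sets. -/

section Curve

variable {E : Type*} [NormedAddCommGroup E] [NormedSpace ℝ E]

/-- In dimension at least two a line has empty interior, so an open set contains points off the line
through `p` and `q`. -/
theorem exists_mem_linearIndependent_sub (hE : 1 < Module.rank ℝ E) {O : Set E} (hO : IsOpen O)
    (hne : O.Nonempty) {p q : E} (hpq : p ≠ q) :
    ∃ y ∈ O, LinearIndependent ℝ ![q - p, y - q] := by
  by_contra! h
  have hspan : ∀ y ∈ O, y - q ∈ Submodule.span ℝ {q - p} := by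
    intro y hy
    have h1 := h y hy
    rw [LinearIndependent.pair_iff' (sub_ne_zero.2 hpq.symm)] at h1
    push Not at h1
    exact Submodule.mem_span_singleton.2 h1
  have htop : Submodule.span ℝ {q - p} = ⊤ := by
    refine Submodule.eq_top_of_nonempty_interior' _ ?_
    obtain ⟨y, hy⟩ := hne
    have hO' : IsOpen ((fun z => z + q) ⁻¹' O) := hO.preimage (by fun_prop)
    refine ⟨y - q, interior_maximal (t := (fun z => z + q) ⁻¹' O) (fun z hz => ?_) hO' ?_⟩
    · simpa using hspan _ hz
    · simpa using hy
  have h2 := rank_span_le (R := ℝ) ({q - p} : Set E)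
  rw [htop, rank_top, Cardinal.mk_singleton] at h2
  exact absurd hE (not_lt.2 h2)

theorem exists_seq_linearIndependent_sub (hE : 1 < Module.rank ℝ E) {O : ℕ → Set E}
    (hO : ∀ k, IsOpen (O k)) (hne : ∀ k, (O k).Nonempty) {p q : E} (hpq : p ≠ q) :
    ∃ f : ℕ → E, f 0 = p ∧ f 1 = q ∧
      ∀ k, f (k + 2) ∈ O k ∧ LinearIndependent ℝ ![f (k + 1) - f k, f (k + 2) - f (k + 1)] := by
  have hnext : ∀ (k : ℕ) (s : {s : E × E // s.1 ≠ s.2}), ∃ s' : {s : E × E // s.1 ≠ s.2},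
      s'.1.1 = s.1.2 ∧ s'.1.2 ∈ O k ∧ LinearIndependent ℝ ![s.1.2 - s.1.1, s'.1.2 - s.1.2] := by
    intro k s
    obtain ⟨y, hy, hli⟩ := exists_mem_linearIndependent_sub hE (hO k) (hne k) s.2
    refine ⟨⟨(s.1.2, y), fun h => hli.ne_zero 1 ?_⟩, rfl, hy, hli⟩
    simpa [sub_eq_zero] using (h : s.1.2 = y).symm
  choose next h1 h2 h3 using hnext
  let s : ℕ → {s : E × E // s.1 ≠ s.2} := fun k => Nat.rec ⟨(p, q), hpq⟩ next k
  have hs : ∀ k, s (k + 1) = next k (s k) := fun _ => rfl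
  have hf : ∀ k, (s (k + 1)).1.1 = (s k).1.2 := fun k => by rw [hs, h1]
  refine ⟨fun k => (s k).1.1, rfl, hf 0, fun k => ⟨?_, ?_⟩⟩
  · change (s (k + 1 + 1)).1.1 ∈ O k
    rw [hf, hs]; exact h2 _ _
  · change LinearIndependent ℝ ![(s (k + 1)).1.1 - (s k).1.1, (s (k + 1 + 1)).1.1 - (s (k + 1)).1.1]
    rw [hf, hf, hs]; exact h3 _ _

/-- A choice of points from consecutive intersections of a simple chain of open sets, no three
consecutive ones of which are collinear. -/
theorem exists_int_seq_linearIndependent_sub (hE : 1 < Module.rank ℝ E) {C : ℤ → Set E}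
    (hC : ∀ i, IsOpen (C i)) (hm : ∀ i, ¬ Disjoint (C i) (C (i + 1)))
    (hd : ∀ i j, i + 2 ≤ j → Disjoint (C i) (C j)) :
    ∃ x : ℤ → E, (∀ i, x i ∈ C (i - 1) ∩ C i) ∧
      ∀ i, LinearIndependent ℝ ![x i - x (i - 1), x (i + 1) - x i] := by
  have hO : ∀ i, IsOpen (C (i - 1) ∩ C i) := fun i => (hC _).inter (hC _)
  have hne : ∀ i, (C (i - 1) ∩ C i).Nonempty := fun i => by
    have := hm (i - 1)
    rwa [sub_add_cancel, Set.not_disjoint_iff_nonempty_inter] at this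
  obtain ⟨p, hp⟩ := hne 0
  obtain ⟨q, hq⟩ := hne 1
  have hpq : p ≠ q := by
    rintro rfl
    exact Set.disjoint_left.1 (hd (0 - 1) 1 (by norm_num)) hp.1 hq.2
  obtain ⟨f, hf0, hf1, hf⟩ := exists_seq_linearIndependent_sub hE
    (O := fun k : ℕ => C ((k + 2 : ℤ) - 1) ∩ C (k + 2)) (fun k => hO _) (fun k => hne _) hpq
  obtain ⟨b, hb0, hb1, hb⟩ := exists_seq_linearIndependent_sub hE
    (O := fun k : ℕ => C ((-k - 1 : ℤ) - 1) ∩ C (-k - 1)) (fun k => hO _) (fun k => hne _) hpq.symm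
  -- The forward sequence starts with `p, q` and the backward one with `q, p`, so `b n` is the
  -- vertex of index `1 - n`. Reversing three vertices only swaps the two differences and changes
  -- their signs.
  let x : ℤ → E := fun z => Int.casesOn z f fun n => b (n + 2)
  have hxf : ∀ n : ℕ, x n = f n := fun _ => rfl
  have hxb : ∀ n : ℕ, x (1 - n) = b n := by
    rintro (_ | _ | n)
    · simpa [hb0, hf1] using hxf 1
    · simpa [hb1, hf0] using hxf 0
    · have : (1 - (n + 1 + 1 : ℕ) : ℤ) = Int.negSucc n := by omega
      rw [this]
  refine ⟨x, fun i => ?_, fun i => ?_⟩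
  · rcases i with (_ | _ | n) | n
    · change f 0 ∈ C (0 - 1) ∩ C 0
      rwa [hf0]
    · change f 1 ∈ C (1 - 1) ∩ C 1
      rwa [hf1]
    · exact (hf n).1
    · have : Int.negSucc n = -n - 1 := by omega
      rw [this] at *
      have h2 := hxb (n + 2)
      have h3 : (1 - (n + 2 : ℕ) : ℤ) = -n - 1 := by push_cast; ring
      rw [h3] at h2
      rw [h2]
      exact (hb n).1
  · rcases lt_or_ge 0 i with hi | hi
    · obtain ⟨n, rfl⟩ : ∃ n : ℕ, i = n + 1 := ⟨(i - 1).toNat, by omega⟩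
      have h1 : ((n : ℤ) + 1 - 1) = n := by ring
      have h2 := hxf (n + 1)
      have h3 := hxf (n + 2)
      push_cast at h2 h3
      have h4 : (n : ℤ) + 1 + 1 = n + 2 := by ring
      rw [h1, h4, hxf, h2, h3]
      exact (hf n).2
    · obtain ⟨n, rfl⟩ : ∃ n : ℕ, i = -n := ⟨(-i).toNat, by omega⟩
      have h1 := hxb n
      have h2 := hxb (n + 1)
      have h3 := hxb (n + 2)
      have e2 : (1 - (n + 1 : ℕ) : ℤ) = -n := by push_cast; ring
      have e3 : (1 - (n + 2 : ℕ) : ℤ) = -n - 1 := by push_cast; ring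
      have e1 : (1 - n : ℤ) = -n + 1 := by ring
      rw [e1] at h1
      rw [e2] at h2
      rw [e3] at h3
      rw [h1, h2, h3]
      have h := (hb n).2
      rw [LinearIndependent.pair_iff] at h ⊢
      intro s t hst
      have := h (-t) (-s) (by rw [← hst]; module)
      exact ⟨neg_eq_zero.1 this.2, neg_eq_zero.1 this.1⟩

/-- A smooth function that vanishes on `(-∞, -η]` and is the identity on `[η, ∞)`. -/
noncomputable def smoothRamp (η t : ℝ) : ℝ := t * Real.smoothTransition ((t / η + 1) / 2)

theorem contDiff_smoothRamp (η : ℝ) : ContDiff ℝ ∞ (smoothRamp η) := by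
  have : ContDiff ℝ ∞ Real.smoothTransition := Real.smoothTransition.contDiff
  exact contDiff_id.mul (this.comp (by fun_prop))

theorem smoothRamp_of_le_neg {η t : ℝ} (hη : 0 < η) (ht : t ≤ -η) : smoothRamp η t = 0 := by
  have : t / η ≤ -1 := by rw [div_le_iff₀ hη]; linarith
  rw [smoothRamp, Real.smoothTransition.zero_of_nonpos (by linarith), mul_zero]

theorem smoothRamp_of_le {η t : ℝ} (hη : 0 < η) (ht : η ≤ t) : smoothRamp η t = t := by
  have : 1 ≤ t / η := by rwa [one_le_div hη]
  rw [smoothRamp, Real.smoothTransition.one_of_one_le (by linarith), mul_one]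

theorem abs_smoothRamp_le (η t : ℝ) : |smoothRamp η t| ≤ |t| := by
  rw [smoothRamp, abs_mul, abs_of_nonneg (Real.smoothTransition.nonneg _)]
  exact mul_le_of_le_one_right (abs_nonneg _) (Real.smoothTransition.le_one _)

/-- A smooth curve arriving at the origin with velocity `u` and leaving it with velocity `v`, with
the corner rounded off at scale `η`. -/
noncomputable def roundedCorner (η : ℝ) (u v : E) (t : ℝ) : E :=
  (t - smoothRamp η t) • u + smoothRamp η t • v

theorem contDiff_roundedCorner (η : ℝ) (u v : E) : ContDiff ℝ ∞ (roundedCorner η u v) :=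
  ((contDiff_id.sub (contDiff_smoothRamp η)).smul contDiff_const).add
    ((contDiff_smoothRamp η).smul contDiff_const)

theorem roundedCorner_of_le_neg {η t : ℝ} (hη : 0 < η) (ht : t ≤ -η) (u v : E) :
    roundedCorner η u v t = t • u := by
  simp [roundedCorner, smoothRamp_of_le_neg hη ht]

theorem roundedCorner_of_le {η t : ℝ} (hη : 0 < η) (ht : η ≤ t) (u v : E) :
    roundedCorner η u v t = t • v := by
  simp [roundedCorner, smoothRamp_of_le hη ht]

theorem norm_roundedCorner_le (η : ℝ) (u v : E) (t : ℝ) :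
    ‖roundedCorner η u v t‖ ≤ |t| * (2 * ‖u‖ + ‖v‖) := by
  have h := abs_smoothRamp_le η t
  have h2 : |t - smoothRamp η t| ≤ 2 * |t| := (abs_sub _ _).trans (by linarith)
  calc ‖roundedCorner η u v t‖ ≤ |t - smoothRamp η t| * ‖u‖ + |smoothRamp η t| * ‖v‖ := by
        refine (norm_add_le _ _).trans ?_
        rw [norm_smul, norm_smul, Real.norm_eq_abs, Real.norm_eq_abs]
    _ ≤ 2 * |t| * ‖u‖ + |t| * ‖v‖ := by gcongr
    _ = _ := by ring

/-- The coordinates with respect to `u` and `v` add up to `t`, so the curve determines its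
parameter; likewise the coordinates of its derivative add up to `1`. -/
theorem injective_roundedCorner (η : ℝ) {u v : E} (h : LinearIndependent ℝ ![u, v]) :
    Function.Injective (roundedCorner η u v) := by
  intro s t hst
  rw [LinearIndependent.pair_iff] at h
  have := h (s - smoothRamp η s - (t - smoothRamp η t)) (smoothRamp η s - smoothRamp η t) (by
    rw [← sub_eq_zero] at hst
    rw [← hst, roundedCorner, roundedCorner]
    module)
  linarith [this.1, this.2]

theorem deriv_roundedCorner_ne_zero (η : ℝ) {u v : E} (h : LinearIndependent ℝ ![u, v]) (t : ℝ) :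
    deriv (roundedCorner η u v) t ≠ 0 := by
  have hr : HasDerivAt (smoothRamp η) (deriv (smoothRamp η) t) t :=
    ((contDiff_smoothRamp η).differentiable (by simp) t).hasDerivAt
  have hd : HasDerivAt (roundedCorner η u v)
      ((1 - deriv (smoothRamp η) t) • u + deriv (smoothRamp η) t • v) t :=
    (((hasDerivAt_id t).sub hr).smul_const u).add (hr.smul_const v)
  rw [hd.deriv]
  intro h0
  have := LinearIndependent.pair_iff.1 h _ _ h0
  linarith [this.1, this.2]

/-- A simple chain of convex open sets in dimension at least two is traversed by a smooth regular
curve without self-intersections. -/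
theorem exists_contDiff_injective_of_int_simple_chain (hE : 1 < Module.rank ℝ E) {C : ℤ → Set E}
    (hC : ∀ i, IsOpen (C i)) (hconv : ∀ i, Convex ℝ (C i))
    (hm : ∀ i, ¬ Disjoint (C i) (C (i + 1))) (hd : ∀ i j, i + 2 ≤ j → Disjoint (C i) (C j)) :
    ∃ g : ℝ → E, ContDiff ℝ ∞ g ∧ (∀ t, deriv g t ≠ 0) ∧ Function.Injective g ∧
      ∀ t, g t ∈ C ⌊t⌋ := by
  obtain ⟨x, hx, hli⟩ := exists_int_seq_linearIndependent_sub hE hC hm hd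
  -- The rounding scale keeps each corner inside the intersection containing its vertex. The bound
  -- `1 / 4` keeps neighbouring corners apart and makes the half-integers, where `round` switches
  -- pieces, lie on straight parts.
  have hη : ∀ i, ∃ η : ℝ, 0 < η ∧ η ≤ 1 / 4 ∧ ∀ t, |t| ≤ η →
      x i + roundedCorner η (x i - x (i - 1)) (x (i + 1) - x i) t ∈ C (i - 1) ∩ C i := by
    intro i
    obtain ⟨ρ, hρ, hρC⟩ := Metric.isOpen_iff.1 ((hC (i - 1)).inter (hC i)) (x i) (hx i)
    set N := 2 * ‖x i - x (i - 1)‖ + ‖x (i + 1) - x i‖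
    have hN : 0 ≤ N := by positivity
    refine ⟨min (1 / 4) (ρ / (N + 1)), by positivity, min_le_left _ _, fun t ht => hρC ?_⟩
    rw [mem_ball, dist_eq_norm, add_sub_cancel_left]
    refine (norm_roundedCorner_le _ _ _ _).trans_lt ?_
    have h1 : |t| ≤ ρ / (N + 1) := ht.trans (min_le_right _ _)
    rw [le_div_iff₀ (by positivity)] at h1
    rcases (abs_nonneg t).eq_or_lt with h0 | h0
    · rw [← h0, zero_mul]; exact hρ
    · linarith
  choose η hη0 hη4 hηC using hη
  let G : ℤ → ℝ → E := fun i t =>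
    x i + roundedCorner (η i) (x i - x (i - 1)) (x (i + 1) - x i) (t - i)
  have hGl : ∀ (i : ℤ) (t : ℝ), i + η i ≤ t → G i t = x i + (t - i) • (x (i + 1) - x i) :=
    fun i t ht => congrArg _ (roundedCorner_of_le (hη0 i) (by linarith) _ _)
  have hGG : ∀ (i : ℤ) (t : ℝ), i + η i ≤ t → t ≤ i + 1 - η (i + 1) → G i t = G (i + 1) t := by
    intro i t h1 h2
    have h3 : G (i + 1) t = x (i + 1) + (t - (i + 1 : ℤ)) • (x (i + 1) - x (i + 1 - 1)) :=
      congrArg _ (roundedCorner_of_le_neg (hη0 _) (by push_cast; linarith) _ _)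
    rw [hGl i t h1, h3, add_sub_cancel_right]
    push_cast
    module
  let g : ℝ → E := fun t => G (round t) t
  have hgG : ∀ (i : ℤ) (t : ℝ), i - 1 + η (i - 1) ≤ t → t ≤ i + 1 - η (i + 1) → g t = G i t := by
    intro i t h1 h2
    have hr := abs_le.1 (abs_sub_round t)
    have hr1 : round t < i + 2 := by
      have : (round t : ℝ) < (i + 2 : ℤ) := by push_cast; linarith [hη0 (i + 1)]
      exact_mod_cast this
    have hr2 : i - 2 < round t := by
      have : ((i - 2 : ℤ) : ℝ) < round t := by push_cast; linarith [hη0 (i - 1)]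
      exact_mod_cast this
    obtain h | h | h : round t = i ∨ round t = i + 1 ∨ round t = i - 1 := by omega
    · simp only [g, h]
    · simp only [g, h]
      refine (hGG i t ?_ h2).symm
      rw [h] at hr; push_cast at hr
      linarith [hη4 i]
    · simp only [g, h]
      have := hGG (i - 1) t (by push_cast; linarith) (by
        have e : i - 1 + 1 = i := sub_add_cancel i 1
        rw [h] at hr; push_cast at hr ⊢
        rw [e]
        linarith [hη4 i])
      rwa [sub_add_cancel] at this
  have hcorner : ∀ (i : ℤ) (t : ℝ), |t - i| ≤ η i → g t ∈ C (i - 1) ∩ C i := by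
    intro i t ht
    have h := abs_le.1 ht
    rw [hgG i t (by linarith [hη4 i, hη4 (i - 1)]) (by linarith [hη4 i, hη4 (i + 1)])]
    exact hηC i _ ht
  have hloc : ∀ (i : ℤ) (t : ℝ), i ≤ t → t ≤ i + 1 → g t ∈ C i := by
    intro i t h1 h2
    rcases le_or_gt t (i + η i) with h3 | h3
    · exact (hcorner i t (abs_le.2 ⟨by linarith [hη0 i], by linarith⟩)).2
    rcases le_or_gt (i + 1 - η (i + 1)) t with h4 | h4
    · have := (hcorner (i + 1) t (abs_le.2
        ⟨by push_cast; linarith, by push_cast; linarith [hη0 (i + 1)]⟩)).1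
      rwa [add_sub_cancel_right] at this
    · rw [hgG i t (by linarith [hη4 (i - 1)]) h4.le, hGl i t h3.le]
      have hxi : x (i + 1) ∈ C i := by
        have := (hx (i + 1)).1
        rwa [add_sub_cancel_right] at this
      exact (hconv i).add_smul_sub_mem (hx i).2 hxi ⟨by linarith, by linarith⟩
  have hGinj : ∀ (i : ℤ) (s t : ℝ), G i s = G i t → s = t := fun i s t h => by
    have := injective_roundedCorner (η i) (hli i) (add_left_cancel h)
    linarith
  -- Two parameters either lie on a single piece `G`, consisting of one corner with its two straight
  -- legs, which is injective, or their images lie in chain members at least two indices apart,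
  -- which are disjoint. A point on a corner belongs to two members, and the more distant one is
  -- used.
  have hlt : ∀ s t : ℝ, s < t → g s ≠ g t := by
    intro s t hst h
    have hdis : ∀ i j, i + 2 ≤ j → g s ∈ C i → g t ∈ C j → False := fun i j hij h1 h2 =>
      Set.disjoint_left.1 (hd i j hij) h1 (h ▸ h2)
    have hs1 := Int.floor_le s
    have hs2 := (Int.lt_floor_add_one s).le
    have ht1 := Int.floor_le t
    have ht2 := (Int.lt_floor_add_one t).le
    have hs := hloc _ s hs1 hs2
    have ht := hloc _ t ht1 ht2
    generalize ⌊s⌋ = i at *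
    have hij : i ≤ ⌊t⌋ := Int.le_floor.2 (hs1.trans hst.le)
    generalize ⌊t⌋ = j at *
    have hsl : s < i + η i → g s ∈ C (i - 1) := fun h' =>
      (hcorner i s (abs_le.2 ⟨by linarith [hη0 i], by linarith⟩)).1
    have htl : j + 1 - η (j + 1) < t → g t ∈ C (j + 1) := fun h' =>
      (hcorner (j + 1) t (abs_le.2
        ⟨by push_cast; linarith, by push_cast; linarith [hη0 (j + 1)]⟩)).2
    rcases lt_or_ge s (i + η i) with h1 | h1
    · rcases hij.eq_or_lt with rfl | hij'
      · rcases lt_or_ge (i + 1 - η (i + 1)) t with h2 | h2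
        · exact hdis _ _ (by omega) (hsl h1) (htl h2)
        · refine hst.ne (hGinj i s t ?_)
          rw [← hgG i s (by linarith [hη4 (i - 1)]) (by linarith),
            ← hgG i t (by linarith [hη4 (i - 1)]) h2, h]
      · exact hdis _ _ (by omega) (hsl h1) ht
    · have hGs : s ≤ i + 2 - η (i + 2) → g s = G (i + 1) s := fun h' =>
        hgG (i + 1) s (by rw [add_sub_cancel_right]; push_cast; linarith)
          (by rw [add_assoc]; push_cast; linarith)
      have hGt : t ≤ i + 2 - η (i + 2) → g t = G (i + 1) t := fun h' =>
        hgG (i + 1) t (by rw [add_sub_cancel_right]; push_cast; linarith)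
          (by rw [add_assoc]; push_cast; linarith)
      rcases lt_or_ge (i + 2 - η (i + 2)) t with h2 | h2
      · rcases lt_or_ge j (i + 2) with hj | hj
        · have hj' : j = i + 1 := by
            have : (i : ℝ) < j := by linarith [hη4 (i + 2)]
            have : i < j := by exact_mod_cast this
            omega
          subst hj'
          refine hdis i _ ?_ hs (htl ?_)
          · omega
          · rw [add_assoc]; push_cast; linarith
        · exact hdis _ _ hj hs ht
      · exact hst.ne (hGinj (i + 1) s t (by rw [← hGs (hst.le.trans h2), ← hGt h2, h]))
  have hev : ∀ t, g =ᶠ[𝓝 t] G (round t) := by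
    intro t
    have hr := abs_le.1 (abs_sub_round t)
    have h1 : (round t : ℝ) - 3 / 4 < t := by linarith
    have h2 : t < (round t : ℝ) + 3 / 4 := by linarith
    filter_upwards [Ioo_mem_nhds h1 h2] with s hs
    exact hgG _ s (by linarith [hs.1, hη4 (round t - 1)]) (by linarith [hs.2, hη4 (round t + 1)])
  refine ⟨g, ?_, fun t => ?_, ?_, fun t => hloc _ t (Int.floor_le t) (Int.lt_floor_add_one t).le⟩
  · refine contDiff_iff_contDiffAt.2 fun t => ContDiffAt.congr_of_eventuallyEq ?_ (hev t)
    exact (contDiff_const.add ((contDiff_roundedCorner _ _ _).comp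
      (contDiff_id.sub contDiff_const))).contDiffAt
  · rw [(hev t).deriv_eq]
    simp only [G]
    rw [deriv_const_add, deriv_comp_sub_const]
    exact deriv_roundedCorner_ne_zero _ (hli _) _
  · intro s t h
    rcases lt_trichotomy s t with h1 | h1 | h1
    · exact absurd h (hlt s t h1)
    · exact h1
    · exact absurd h.symm (hlt t s h1)

end Curve

/-! ### Embedding the open curve and closing up the circle. -/

section Gluing

variable {X : Type*} [TopologicalSpace X] [T2Space X]

/-- An injective curve converging at both ends to points off the curve is an embedding. -/
theorem isEmbedding_of_injective_of_tendsto [LocallyCompactSpace X] {g : ℝ → X} (hg : Continuous g)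
    (hinj : Function.Injective g) {a b : X} (ha : a ∉ range g) (hb : b ∉ range g)
    (hga : Tendsto g atTop (𝓝 a)) (hgb : Tendsto g atBot (𝓝 b)) : IsEmbedding g := by
  have hY : IsOpen ({a, b}ᶜ : Set X) := (toFinite {a, b}).isClosed.isOpen_compl
  have hgY : ∀ t, g t ∈ ({a, b}ᶜ : Set X) := by
    rintro t (h | h)
    · exact ha ⟨t, h⟩
    · exact hb ⟨t, h⟩
  have := hY.locallyCompactSpace
  -- With its limit points removed from the target, the curve leaves every compact set at both ends;
  -- it is proper, hence a closed embedding.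
  let g' : ℝ → ({a, b}ᶜ : Set X) := fun t => ⟨g t, hgY t⟩
  have hg' : Continuous g' := hg.subtype_mk _
  have hout : ∀ {l : Filter ℝ} {c : X}, c ∈ ({a, b} : Set X) → Tendsto g l (𝓝 c) →
      Tendsto g' l (cocompact _) := by
    intro l c hc hl
    refine (hasBasis_cocompact.tendsto_right_iff).2 fun K hK => ?_
    have hK' : IsClosed (Subtype.val '' K) := (hK.image continuous_subtype_val).isClosed
    have hcK : c ∈ (Subtype.val '' K)ᶜ := by
      rintro ⟨y, -, rfl⟩
      exact y.2 hc
    filter_upwards [hl.eventually (hK'.isOpen_compl.mem_nhds hcK)] with t ht h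
    exact ht ⟨_, h, rfl⟩
  have hproper : IsProperMap g' := by
    refine isProperMap_iff_tendsto_cocompact.2 ⟨hg', ?_⟩
    rw [cocompact_eq_atBot_atTop]
    exact (hout (by simp) hgb).sup (hout (by simp) hga)
  have hcl : IsClosedEmbedding g' := IsClosedEmbedding.of_continuous_injective_isClosedMap hg'
    (fun s t h => hinj (congrArg Subtype.val h)) hproper.isClosedMap
  exact IsEmbedding.subtypeVal.comp hcl.isEmbedding

/-- An arc and an open curve joining its end points form a simple closed curve. -/
theorem isSimpleClosedCurve_range_union_range [RegularSpace X] {α : C(unitInterval, X)}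
    (hα : Function.Injective α) {g : ℝ → X} (hg : Continuous g) (hinj : Function.Injective g)
    (hdisj : Disjoint (range α) (range g)) (hga : Tendsto g atTop (𝓝 (α 0)))
    (hgb : Tendsto g atBot (𝓝 (α 1))) : IsSimpleClosedCurve (range α ∪ range g) := by
  have hπ : -(Real.pi / 2) < Real.pi / 2 := by linarith [Real.pi_pos]
  have hp : 0 < Real.pi + 1 := by positivity
  have : Fact (0 < Real.pi + 1) := ⟨hp⟩
  -- The circle has length `π + 1`: `g ∘ tan` fills the interval of length `π`, extended by its
  -- limits, and `α` the remaining unit interval. The seam, at `-π / 2` and `π / 2 + 1`, is sent to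
  -- `α 1`.
  set F := extendFrom (Ioo (-(Real.pi / 2)) (Real.pi / 2)) (g ∘ Real.tan)
  have htan : ContinuousOn (g ∘ Real.tan) (Ioo (-(Real.pi / 2)) (Real.pi / 2)) :=
    hg.comp_continuousOn Real.continuousOn_tan_Ioo
  have hl : Tendsto (g ∘ Real.tan) (𝓝[>] (-(Real.pi / 2))) (𝓝 (α 1)) :=
    hgb.comp Real.tendsto_tan_neg_pi_div_two
  have hr : Tendsto (g ∘ Real.tan) (𝓝[<] (Real.pi / 2)) (𝓝 (α 0)) :=
    hga.comp Real.tendsto_tan_pi_div_two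
  have hFc : ContinuousOn F (Icc (-(Real.pi / 2)) (Real.pi / 2)) :=
    continuousOn_Icc_extendFrom_Ioo htan hl hr
  have hF0 : F (-(Real.pi / 2)) = α 1 := eq_lim_at_left_extendFrom_Ioo hπ hl
  have hF1 : F (Real.pi / 2) = α 0 := eq_lim_at_right_extendFrom_Ioo hπ hr
  have hFm : ∀ s ∈ Ioo (-(Real.pi / 2)) (Real.pi / 2), F s = g (Real.tan s) := fun s hs =>
    extendFrom_extends htan s hs
  set f : ℝ → X := fun s => if s < Real.pi / 2 then F s else
    α (projIcc 0 1 zero_le_one (s - Real.pi / 2))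
  have hfl : ∀ s ∈ Icc (-(Real.pi / 2)) (Real.pi / 2), f s = F s := by
    intro s hs
    rcases hs.2.lt_or_eq with h | h
    · exact if_pos h
    · have : f s = α (projIcc 0 1 zero_le_one (s - Real.pi / 2)) := if_neg h.not_lt
      rw [this, h, sub_self, hF1, projIcc_left]; rfl
  have hfr : ∀ s, Real.pi / 2 ≤ s → f s = α (projIcc 0 1 zero_le_one (s - Real.pi / 2)) :=
    fun s hs => if_neg (not_lt.2 hs)
  have hfα : ∀ t : unitInterval, f (Real.pi / 2 + t) = α t := by
    intro t
    rw [hfr _ (by linarith [t.2.1]), add_sub_cancel_left, projIcc_val]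
  have hend : -(Real.pi / 2) + (Real.pi + 1) = Real.pi / 2 + 1 := by ring
  have hfc : ContinuousOn f (Icc (-(Real.pi / 2)) (-(Real.pi / 2) + (Real.pi + 1))) := by
    rw [hend, ← Icc_union_Icc_eq_Icc hπ.le (by linarith : Real.pi / 2 ≤ Real.pi / 2 + 1)]
    refine (hFc.congr hfl).union_of_isClosed (ContinuousOn.congr ?_ fun s hs => hfr s hs.1)
      isClosed_Icc isClosed_Icc
    exact (α.continuous.comp (continuous_projIcc.comp (by fun_prop))).continuousOn
  have hfp : f (-(Real.pi / 2)) = f (-(Real.pi / 2) + (Real.pi + 1)) := by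
    rw [hend, hfl _ ⟨le_rfl, hπ.le⟩, hF0]
    exact (hfα 1).symm
  set Φ := AddCircle.liftIco (Real.pi + 1) (-(Real.pi / 2)) f
  have hΦ : Continuous Φ := AddCircle.liftIco_continuous hfp hfc
  have hrep : ∀ z : AddCircle (Real.pi + 1), ∃ s ∈ Ico (-(Real.pi / 2)) (Real.pi / 2 + 1),
      (s : AddCircle (Real.pi + 1)) = z ∧ Φ z = f s := by
    intro z
    have hs := (AddCircle.equivIco (Real.pi + 1) (-(Real.pi / 2)) z).2
    have hz := AddCircle.coe_equivIco (p := Real.pi + 1) (a := -(Real.pi / 2)) (y := z)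
    refine ⟨_, hend ▸ hs, hz, ?_⟩
    conv_lhs => rw [← hz]
    exact AddCircle.liftIco_coe_apply hs
  have hΦf : ∀ s ∈ Ico (-(Real.pi / 2)) (Real.pi / 2 + 1), Φ s = f s := fun s hs =>
    AddCircle.liftIco_coe_apply (hend ▸ hs)
  -- On the half-open period the point `α 1` occurs only at the left end, hence the distinction `t =
  -- 1`.
  have hcases : ∀ s ∈ Ico (-(Real.pi / 2)) (Real.pi / 2 + 1),
      (∃ t : unitInterval, f s = α t ∧
        ((t = 1 ∧ s = -(Real.pi / 2)) ∨ (t ≠ 1 ∧ s = Real.pi / 2 + t))) ∨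
      (s ∈ Ioo (-(Real.pi / 2)) (Real.pi / 2) ∧ f s = g (Real.tan s)) := by
    intro s hs
    rcases hs.1.eq_or_lt with h | h
    · left
      refine ⟨1, ?_, Or.inl ⟨rfl, h.symm⟩⟩
      rw [← h, hfl _ ⟨le_rfl, hπ.le⟩, hF0]
    · rcases lt_or_ge s (Real.pi / 2) with h2 | h2
      · right
        exact ⟨⟨h, h2⟩, by rw [hfl s ⟨h.le, h2.le⟩, hFm s ⟨h, h2⟩]⟩
      · left
        have hs2 := hs.2
        refine ⟨⟨s - Real.pi / 2, by linarith, by linarith⟩, ?_, Or.inr ⟨fun h3 => ?_, ?_⟩⟩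
        · rw [← hfα]; congr 1; simp
        · have : s - Real.pi / 2 = 1 := congrArg Subtype.val h3
          linarith
        · simp
  have hinjf : InjOn f (Ico (-(Real.pi / 2)) (Real.pi / 2 + 1)) := by
    intro s hs s' hs' h
    rcases hcases s hs with ⟨t, ht, hst⟩ | ⟨hsI, ht⟩ <;>
      rcases hcases s' hs' with ⟨t', ht', hst'⟩ | ⟨hsI', ht'⟩
    · have : t = t' := hα (by rw [← ht, ← ht', h])
      subst this
      rcases hst with ⟨h1, h2⟩ | ⟨h1, h2⟩ <;> rcases hst' with ⟨h3, h4⟩ | ⟨h3, h4⟩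
      · rw [h2, h4]
      · exact absurd h1 h3
      · exact absurd h3 h1
      · rw [h2, h4]
    · exact absurd (mem_range_self (f := g) (Real.tan s')) fun hm => Set.disjoint_left.1 hdisj
        (mem_range_self t) (by rw [← ht, h, ht']; exact hm)
    · exact absurd (mem_range_self (f := g) (Real.tan s)) fun hm => Set.disjoint_left.1 hdisj
        (mem_range_self t') (by rw [← ht', ← h, ht]; exact hm)
    · exact Real.injOn_tan hsI hsI' (hinj (by rw [← ht, ← ht', h]))
  have hΦinj : Function.Injective Φ := by
    intro z z' h
    obtain ⟨s, hs, rfl, -⟩ := hrep z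
    obtain ⟨s', hs', rfl, -⟩ := hrep z'
    rw [hΦf s hs, hΦf s' hs'] at h
    rw [hinjf hs hs' h]
  have hrange : range Φ = range α ∪ range g := by
    apply Subset.antisymm
    · rintro _ ⟨z, rfl⟩
      obtain ⟨s, hs, -, h⟩ := hrep z
      rw [h]
      rcases hcases s hs with ⟨t, ht, -⟩ | ⟨-, ht⟩
      · exact Or.inl (ht ▸ mem_range_self t)
      · exact Or.inr (ht ▸ mem_range_self _)
    · rintro _ (⟨t, rfl⟩ | ⟨t, rfl⟩)
      · rcases eq_or_ne t 1 with rfl | h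
        · refine ⟨(-(Real.pi / 2) : ℝ), ?_⟩
          rw [hΦf _ ⟨le_rfl, by linarith⟩, hfl _ ⟨le_rfl, hπ.le⟩, hF0]
        · have h1 : (t : ℝ) < 1 := lt_of_le_of_ne t.2.2 fun h' => h (Subtype.ext h')
          refine ⟨(Real.pi / 2 + t : ℝ), ?_⟩
          rw [hΦf _ ⟨by linarith [t.2.1], by linarith⟩, hfα]
      · have h1 := Real.neg_pi_div_two_lt_arctan t
        have h2 := Real.arctan_lt_pi_div_two t
        refine ⟨(Real.arctan t : ℝ), ?_⟩
        rw [hΦf _ ⟨by linarith, by linarith⟩, hfl _ ⟨by linarith, h2.le⟩,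
          hFm _ ⟨by linarith, h2⟩, Real.tan_arctan]
  have hemb : IsEmbedding Φ := (hΦ.isClosedEmbedding hΦinj).isEmbedding
  rw [IsSimpleClosedCurve, ← hrange]
  exact ⟨hemb.toHomeomorph.symm.trans (AddCircle.homeomorphCircle hp.ne')⟩

end Gluing

/-! ### Closing up the arc. -/

theorem theorem1p2 (n : ℕ) (hn : 2 ≤ n) (L Ω : Set (EuclideanSpace ℝ (Fin n)))
    (hL : IsArc L) (hΩ : IsOpen Ω) (hLΩ : L ⊆ Ω) :
    ∃ Γ : Set (EuclideanSpace ℝ (Fin n)),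
      IsSimpleClosedCurve Γ ∧ Γ ⊆ Ω ∧ L ⊆ Γ ∧ IsSmoothOpenArc (Γ \ L) := by
  obtain ⟨e⟩ := hL
  let α : C(unitInterval, EuclideanSpace ℝ (Fin n)) :=
    ⟨fun t => e.symm t, continuous_subtype_val.comp e.symm.continuous⟩
  have hα : Function.Injective α := Subtype.val_injective.comp e.symm.injective
  have hαL : range α = L := by
    have : range α = Subtype.val '' range e.symm := range_comp Subtype.val e.symm
    rw [this, e.symm.surjective.range_eq, image_univ, Subtype.range_coe]
  have hE : 1 < Module.rank ℝ (EuclideanSpace ℝ (Fin n)) := by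
    rw [← Module.finrank_eq_rank, finrank_euclideanSpace_fin]
    exact_mod_cast hn
  rw [← hαL] at hLΩ ⊢
  obtain ⟨C, hCo, hCc, hCΩ, hCm, hCd, hC0, hC1⟩ := exists_int_simple_chain_closing_arc hE hα hΩ hLΩ
  obtain ⟨g, hg, hg', hginj, hgC⟩ :=
    exists_contDiff_injective_of_int_simple_chain hE hCo hCc hCm hCd
  have hdisj : Disjoint (range α) (range g) := by
    rw [Set.disjoint_right]
    rintro _ ⟨t, rfl⟩
    exact (hCΩ _ (hgC t)).2
  have hga : Tendsto g atTop (𝓝 (α 0)) := Metric.nhds_basis_ball.tendsto_right_iff.2 fun ε hε =>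
    (tendsto_floor_atTop.eventually (hC0 ε hε)).mono fun t ht => ht (hgC t)
  have hgb : Tendsto g atBot (𝓝 (α 1)) := Metric.nhds_basis_ball.tendsto_right_iff.2 fun ε hε =>
    (tendsto_floor_atBot.eventually (hC1 ε hε)).mono fun t ht => ht (hgC t)
  refine ⟨range α ∪ range g,
    isSimpleClosedCurve_range_union_range hα hg.continuous hginj hdisj hga hgb,
    union_subset hLΩ ?_, subset_union_left, g, hg, hg', ?_, ?_⟩
  · rintro _ ⟨t, rfl⟩
    exact (hCΩ _ (hgC t)).1
  · exact isEmbedding_of_injective_of_tendsto hg.continuous hginj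
      (Set.disjoint_left.1 hdisj (mem_range_self 0)) (Set.disjoint_left.1 hdisj (mem_range_self 1))
      hga hgb
  · rw [union_sdiff_left, hdisj.symm.sdiff_eq_left]
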